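/- Conventions. Work in the Euclidean space $\mathbb{R}^d$; "smooth" means $C^2$. For $A\subset\mathbb{R}^d$ let $d_A(y)=\inf_{a\in A}\|y-a\|$ and $\complement A=\overline{\mathbb{R}^d\setminus A}$; for $r>0$ let $A^{-r}=\{y : d_{\complement A}(y)\ge r\}$. The reach of a closed set $A$ is the supremum of the $t\ge 0$ such that every $y$ with $d_A(y)<t$ has a unique closest point in $A$. The Clarke gradient $\partial^*\phi(y)$ of a locally Lipschitz $\phi$ is the convex hull of the limits of $\nabla\phi(y_i)$, $y_i\to y$, where $\phi$ is differentiable at each $y_i$; for $\mu\in(0,1]$, $\mathrm{reach}_\mu(A)$ is the supremum of the $s\ge 0$ such that every element of $\partial^* d_A(y)$ has norm at least $\mu$ whenever $0<d_A(y)\le s$. A compact set $X$ is *complementary regular* if $\overline{\mathrm{int}(X)}=X$, $\mathrm{reach}_\mu(X)>0$ for some $\mu\in(0,1]$, and $\mathrm{reach}(\complement X)>0$. $\mathrm{Tan}(A,y)$ is the cone of tangent vectors to $A$ at $y\in A$: $0$ and all nonnegative multiples of limits of $(y_i-y)/\|y_i-y\|$ with $y_i\in A\setminus\{y\}$, $y_i\to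 y$. If $A$ has positive reach, $\mathrm{Nor}(A,y)$ is the polar cone $\mathrm{Tan}(A,y)^{\mathrm{o}}$. If $\complement X$ has positive reach and is fully dimensional (its tangent cones at boundary points span $\mathbb{R}^d$; equivalently it is a Lipschitz domain), we say that $X$ admits a normal bundle, and put $\mathrm{Nor}(X,y)=-\mathrm{Nor}(\complement X,y)$ for $y\in\partial X$ and $\mathrm{Nor}(X,y)=\{0\}$ for $y\in\mathrm{int}(X)$. In both cases the unit normal bundle is $\mathrm{Nor}(X)=\{(y,n): y\in\partial X,\ n\in\mathrm{Nor}(X,y),\ \|n\|=1\}$. A pair $(y,n)\in\mathrm{Nor}(X)$ is *regular* if $T=\mathrm{Tan}(\mathrm{Nor}(X),(y,n))$ is a vector space of dimension $d-1$. The *principal curvatures* at $(y,n)$ are $\kappa_1,\dots,\kappa_{d-1}\in\mathbb{R}\cup\{\infty\}$ for which there are $b_1,\dots,b_{d-1}\perp n$ such that the vectors $\big(\tfrac{1}{\sqrt{1+\kappa_i^2}}b_i,\tfrac{\kappa_i}{\sqrt{1+\kappa_i^2}}b_i\big)$ (read as $(0,b_i)$ if $\kappa_i=\infty$) form an orthonormal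 basis of $T$. Let $f:\mathbb{R}^d\to\mathbb{R}$ be smooth. A point $y\in X$ is a *critical point* of $f_{|X}$ if $\nabla f(y)\in-\mathrm{Nor}(X,y)$. If $\nabla f(y)\ne0$ and $(y,-\nabla f(y)/\|\nabla f(y)\|)$ is a regular pair of $\mathrm{Nor}(X)$ with tangent space $T$, the Hessian of $f_{|X}$ at $y$ is the bilinear form on $\pi_0(T)=\{u:(u,v)\in T\}$ given by $H_yf_{|X}(u,u')=H_yf(u,u')+\|\nabla f(y)\|\langle u,v'\rangle$ where $(u',v')\in T$; its index is the largest dimension of a subspace on which it is negative definite. A critical point $y$ is *non-degenerate* if $\nabla f(y)\neq 0$, that pair is regular, and this Hessian is non-degenerate. **Lemma.** Let $X\subset\mathbb{R}^d$ be complementary regular, $f:\mathbb{R}^d\to\mathbb{R}$ smooth, and $x$ a non-degenerate critical point of $f_{|X}$. Put $\nu=\nabla f(x)/\|\nabla f(x)\|$ and, for $r>0$, $f_r(y)=f(y-r\nu)$ and $x^r=x+r\nu$. 1. For all $0<r<\mathrm{reach}(\complement X)$, the set $X^{-r}$ admits a normal bundle, $x^r$ is a critical point of $f_{r|X^{-r}}$,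 and $f_r(x^r)=f(x)$. 2. The set $\complement X$ (of positive reach) has a family of principal curvatures at $(x,\nu)$, and there is $r_0>0$ such that for all $0<r<r_0$ the point $x^r$ is a non-degenerate critical point of $f_{r|X^{-r}}$, and the index of the Hessian of $f_{r|X^{-r}}$ at $x^r$ equals the index of the Hessian of $f_{|X}$ at $x$ plus the number of infinite principal curvatures of $\complement X$ at $(x,\nu)$ (for every family of principal curvatures there). -/

import Mathlib

open Filter Topology
open scoped NNReal ENNReal RealInnerProductSpace

noncomputable section

namespace ComplementaryRegular

/-! ### Sets, distance functions, reach -/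

/-- The Euclidean space `ℝ^d`. -/
abbrev E (d : ℕ) : Type := EuclideanSpace ℝ (Fin d)

variable {d : ℕ}

/-- The complement set of `X`: the closure of the set-theoretic complement. -/
def closedCompl (X : Set (E d)) : Set (E d) := closure Xᶜ

/-- The eroded set (counter-offset) `X^{-r}`: the points at distance at least `r` from the
complement set of `X`. -/
def erosion (X : Set (E d)) (r : ℝ) : Set (E d) := {x | r ≤ Metric.infDist x (closedCompl X)}

/-- The Clarke gradient of `φ` at `x`: the convex hull of all limits of gradients `∇φ(x_i)` along
sequences `x_i → x` of points of differentiability of `φ`. -/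
def clarkeGradient (φ : E d → ℝ) (x : E d) : Set (E d) :=
  convexHull ℝ {v | ∃ u : ℕ → E d, (∀ i, DifferentiableAt ℝ φ (u i)) ∧
    Tendsto u atTop (𝓝 x) ∧ Tendsto (fun i => gradient φ (u i)) atTop (𝓝 v)}

/-- The `μ`-reach of `X`: the supremum of the `s ≥ 0` such that, at every point `x ∉ X` with
`d_X(x) ≤ s`, all elements of the Clarke gradient of `d_X` have norm at least `μ`. -/
def muReach (μ : ℝ) (X : Set (E d)) : ℝ≥0∞ :=
  sSup {t | ∃ s : ℝ≥0, t = s ∧ ∀ x : E d, 0 < Metric.infDist x X → Metric.infDist x X ≤ s →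
    μ ≤ Metric.infDist 0 (clarkeGradient (fun y => Metric.infDist y X) x)}

/-- The reach of a (closed) set `A`: the largest `t` such that every `x` with `d_A(x) < t` has a
unique closest point in `A`. -/
def reach (A : Set (E d)) : ℝ≥0∞ :=
  sSup {t | ∃ s : ℝ≥0, t = s ∧ ∀ x : E d, Metric.infDist x A < s →
    ∃! a, a ∈ A ∧ dist x a = Metric.infDist x A}

/-- Complementary regular sets. -/
structure IsComplementaryRegular (X : Set (E d)) : Prop where
  isCompact : IsCompact X
  closure_interior : closure (interior X) = X
  muReach_pos : ∃ μ : ℝ, 0 < μ ∧ μ ≤ 1 ∧ 0 < muReach μ X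
  reach_compl_pos : 0 < reach (closedCompl X)

/-! ### Tangent cones, normal cones, normal bundles -/

/-- The tangent cone `Tan(A, x)`, for `x ∈ A`: the vectors `lim c_i • (x_i - x)` with `c_i ≥ 0`,
`x_i ∈ A` and `x_i → x`, i.e. `0` together with the nonnegative multiples of the limits of
`(x_i - x) / ‖x_i - x‖` for `x_i ∈ A \ {x}` and `x_i → x`. -/
def tangentCone {V : Type*} [NormedAddCommGroup V] [NormedSpace ℝ V] (A : Set V) (x : V) : Set V :=
  tangentConeAt ℝ≥0 A x

/-- The polar cone of `B`. -/
def polarCone (B : Set (E d)) : Set (E d) := {u | ∀ b ∈ B, ⟪u, b⟫ ≤ 0}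

/-- A set (of positive reach) is fully dimensional when all its tangent cones at boundary points
span the whole space; for sets of positive reach this means being a Lipschitz domain. -/
def IsFullyDimensional (A : Set (E d)) : Prop :=
  ∀ x ∈ frontier A, Submodule.span ℝ (tangentCone A x) = ⊤

/-- The normal cone `Nor(A, x) = Tan(A, x)°` of a set `A` of positive reach at `x ∈ A`. -/
def normalConeOfReach (A : Set (E d)) (x : E d) : Set (E d) := polarCone (tangentCone A x)

/-- The unit normal bundle of a set of positive reach. -/
def normalBundleOfReach (A : Set (E d)) : Set (E d × E d) :=
  {p | p.1 ∈ frontier A ∧ p.2 ∈ normalConeOfReach A p.1 ∧ ‖p.2‖ = 1}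

open Classical in
/-- The normal cone `Nor(X, x)` at `x ∈ X` of a set `X` whose complement set has positive reach:
`Nor(X, x) = - Nor(closedCompl X, x)` at boundary points, and `{0}` at interior points. -/
def normalCone (X : Set (E d)) (x : E d) : Set (E d) :=
  if x ∈ interior X then {0} else {u | -u ∈ normalConeOfReach (closedCompl X) x}

/-- The unit normal bundle `Nor(X)` of a set whose complement set has positive reach. -/
def normalBundle (X : Set (E d)) : Set (E d × E d) :=
  {p | p.1 ∈ frontier X ∧ p.2 ∈ normalCone X p.1 ∧ ‖p.2‖ = 1}

/-- The condition under which `X` admits the normal bundle above: its complement set has positive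
reach and is a Lipschitz domain. -/
def AdmitsNormalBundle (X : Set (E d)) : Prop :=
  0 < reach (closedCompl X) ∧ IsFullyDimensional (closedCompl X)

/-- A pair `(x, n)` of a bundle `N` is regular when `Tan(N, (x, n))` is a vector space of
dimension `d - 1`. -/
def IsRegularPair (N : Set (E d × E d)) (p : E d × E d) : Prop :=
  p ∈ N ∧ ∃ T : Submodule ℝ (E d × E d), (T : Set (E d × E d)) = tangentCone N p ∧
    Module.finrank ℝ T + 1 = d

/-- The tangent space of a bundle at a pair (equal to the tangent cone at regular pairs). -/
def tangentSpace (N : Set (E d × E d)) (p : E d × E d) : Submodule ℝ (E d × E d) :=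
  Submodule.span ℝ (tangentCone N p)

/-! ### Principal curvatures -/

/-- The vector `(b / √(1 + κ²), κ b / √(1 + κ²))`, which is `(0, b)` when `κ = ∞`. -/
def principalVector (κ : WithTop ℝ) (b : E d) : E d × E d :=
  match κ with
  | ⊤ => (0, b)
  | (k : ℝ) => ((1 / Real.sqrt (1 + k ^ 2)) • b, (k / Real.sqrt (1 + k ^ 2)) • b)

/-- `κ` is the family of principal curvatures of the bundle `N` at `(x, n)` (finite or infinite,
with multiplicities) and `b` is a family of corresponding principal directions: the `b i` are
orthogonal to `n`, and the vectors `(b i / √(1 + κ i ²), κ i b i / √(1 + κ i ²))` form an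
orthonormal basis of the tangent space of `N` at `(x, n)`, in the Euclidean space
`ℝ^d × ℝ^d`. -/
structure IsPrincipalCurvatures (N : Set (E d × E d)) (x n : E d)
    (κ : Fin (d - 1) → WithTop ℝ) (b : Fin (d - 1) → E d) : Prop where
  orthogonal : ∀ i, ⟪b i, n⟫ = 0
  orthonormal : Orthonormal ℝ (fun i => WithLp.toLp 2 (principalVector (κ i) (b i)))
  span_eq : (Submodule.span ℝ (Set.range fun i => principalVector (κ i) (b i)) :
    Set (E d × E d)) = tangentCone N (x, n)

/-- The number of infinite members of a family of curvatures. -/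
def numInfinite {m : ℕ} (κ : Fin m → WithTop ℝ) : ℕ := Set.ncard {i | κ i = ⊤}

/-! ### Second fundamental form, critical points, Hessian, index -/

/-- The projection `π₀(T)` of a space of pairs onto the first factor. -/
abbrev firstProj (T : Submodule ℝ (E d × E d)) : Submodule ℝ (E d) :=
  T.map (LinearMap.fst ℝ (E d) (E d))

/-- The first projection, as a linear map from `T` onto `π₀(T)`. -/
def toFirstProj (T : Submodule ℝ (E d × E d)) : T →ₗ[ℝ] firstProj T :=
  (LinearMap.fst ℝ (E d) (E d)).submoduleMap T

theorem exists_lift (T : Submodule ℝ (E d × E d)) :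
    ∃ s : firstProj T →ₗ[ℝ] T, toFirstProj T ∘ₗ s = LinearMap.id :=
  (toFirstProj T).exists_rightInverse_of_surjective
    (LinearMap.range_eq_top.2 ((LinearMap.fst ℝ (E d) (E d)).submoduleMap_surjective T))

/-- A linear choice, for every `u ∈ π₀(T)`, of a pair `(u, v) ∈ T`. -/
def liftPair (T : Submodule ℝ (E d × E d)) : firstProj T →ₗ[ℝ] T := Classical.choose (exists_lift T)

/-- The second fundamental form on `π₀(T)`: its value at `(u, u')` is `⟪u, v'⟫` where
`(u', v') ∈ T`. When `T` is the tangent space at a regular pair, `⟪u, v'⟫` does not depend on the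
choice of `v'`. -/
def secondFundamentalForm (T : Submodule ℝ (E d × E d)) : LinearMap.BilinForm ℝ (firstProj T) :=
  LinearMap.mk₂ ℝ (fun u u' => ⟪(u : E d), (liftPair T u' : E d × E d).2⟫)
    (by intro a b c; simp [inner_add_left]) (by intro c a b; simp [inner_smul_left])
    (by intro a b c; simp [inner_add_right]) (by intro c a b; simp [inner_smul_right])

/-- The values of the second fundamental form do not depend on the chosen pairs as soon as the
defining expression does not. -/
theorem secondFundamentalForm_apply (T : Submodule ℝ (E d × E d))
    (hT : ∀ p ∈ T, ∀ w : E d, ((0 : E d), w) ∈ T → ⟪p.1, w⟫ = 0) (p q : T) :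
    secondFundamentalForm T (toFirstProj T p) (toFirstProj T q) =
      ⟪(p : E d × E d).1, (q : E d × E d).2⟫ := by
  have hl : toFirstProj T (liftPair T (toFirstProj T q)) = toFirstProj T q :=
    LinearMap.congr_fun (Classical.choose_spec (exists_lift T)) (toFirstProj T q)
  have hl' : (liftPair T (toFirstProj T q) : E d × E d).1 = (q : E d × E d).1 :=
    congrArg Subtype.val hl
  have hmem : ((liftPair T (toFirstProj T q) - q : T) : E d × E d) ∈ T := Subtype.property _
  have heq : ((liftPair T (toFirstProj T q) - q : T) : E d × E d) =
      (0, (liftPair T (toFirstProj T q) : E d × E d).2 - (q : E d × E d).2) := by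
    ext1
    · simp [hl']
    · simp
  rw [heq] at hmem
  have h0 := hT p p.2 _ hmem
  rw [inner_sub_right, sub_eq_zero] at h0
  exact h0

/-- `x ∈ X` is a critical point of `f` restricted to `X` when `∇f(x) ∈ - Nor(X, x)`. -/
def IsCriticalPoint (f : E d → ℝ) (X : Set (E d)) (x : E d) : Prop :=
  x ∈ X ∧ -gradient f x ∈ normalCone X x

/-- The unit vector `∇f(x) / ‖∇f(x)‖`. -/
def unitGradient (f : E d → ℝ) (x : E d) : E d := ‖gradient f x‖⁻¹ • gradient f x

/-- The tangent space of `Nor(X)` at `(x, -∇f(x) / ‖∇f(x)‖)`. -/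
def criticalTangentSpace (f : E d → ℝ) (X : Set (E d)) (x : E d) : Submodule ℝ (E d × E d) :=
  tangentSpace (normalBundle X) (x, -unitGradient f x)

/-- The Hessian of `f` restricted to `X` at `x`, a bilinear form on the first projection of the
tangent space of `Nor(X)` at `(x, -∇f(x) / ‖∇f(x)‖)`: the sum of the Hessian of `f` and of
`‖∇f(x)‖` times the second fundamental form. -/
def restrictedHessian (f : E d → ℝ) (X : Set (E d)) (x : E d) :
    LinearMap.BilinForm ℝ (firstProj (criticalTangentSpace f X x)) :=
  (ContinuousLinearMap.toLinearMap₁₂ (fderiv ℝ (fderiv ℝ f) x)).domRestrict₁₂ _ _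
    + ‖gradient f x‖ • secondFundamentalForm (criticalTangentSpace f X x)

/-- The index of a bilinear form: the largest dimension of a subspace on which it is negative
definite. -/
def index {V : Type*} [AddCommGroup V] [Module ℝ V] (B : LinearMap.BilinForm ℝ V) : ℕ :=
  sSup {k | ∃ W : Submodule ℝ V, Module.finrank ℝ W = k ∧ ∀ w ∈ W, w ≠ 0 → B w w < 0}

/-- Non-degenerate critical points of `f` restricted to `X`. -/
structure IsNondegenerateCriticalPoint (f : E d → ℝ) (X : Set (E d)) (x : E d) : Prop where
  isCriticalPoint : IsCriticalPoint f X x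
  gradient_ne_zero : gradient f x ≠ 0
  isRegularPair : IsRegularPair (normalBundle X) (x, -unitGradient f x)
  nondegenerate : (restrictedHessian f X x).Nondegenerate

/-- The translated function `f_r(y) = f(y - r ∇f(x) / ‖∇f(x)‖)`. -/
def translatedFun (f : E d → ℝ) (x : E d) (r : ℝ) : E d → ℝ := fun y => f (y - r • unitGradient f x)

/-- The translated point `x^r = x + r ∇f(x) / ‖∇f(x)‖`. -/
def translatedPoint (f : E d → ℝ) (x : E d) (r : ℝ) : E d := x + r • unitGradient f x

end ComplementaryRegular

end

/-!
Let `A` be the closed complement of `X`. For `0 < r < reach A`, and for `r = 0`, the linear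
involution `(u, v) ↦ (u + r v, -v)` carries the unit normal bundle of `X^{-r}` onto that of `A`, so
a single tangent space `T` of the bundle of `A` describes the tangent spaces of all erosions. The
nearest-point projection onto `A` is differentiable at `x + r ν`, and its derivative
`u + r v ↦ u`, `(u, v) ∈ T`, is symmetric, since `y - nearest A y` is half the gradient of
`(infDist y A) ^ 2`. Hence `⟪u, v'⟫ = ⟪u', v⟫` on `T`, and the eigenvectors of this derivative are
principal directions.

Pulled back to `T`, the Hessian of the translated function on `X^{-r}` at `x + r ν` is
`H(u + r v, u' + r v') - g ⟪u + r v, v'⟫`, with `H` the Hessian and `g` the norm of the gradient of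
`f` at `x`. For `r = 0` its kernel is the space of vertical vectors `(0, v) ∈ T`, whose dimension is
the number of infinite principal curvatures. For small `r > 0` it becomes negative on this kernel,
where it is `-g r ‖v‖ ^ 2 + O(r ^ 2)`, and after rescaling the kernel by `r^{-1/2}` the mixed terms
tend to zero: the index increases by the dimension of the kernel.
-/

noncomputable section

namespace ComplementaryRegular

/-! ### Nearest points -/

section NearestPoints

variable {F : Type*} [NormedAddCommGroup F] {A : Set F} {R : ℝ}

/-- `A` is a closed set of reach at least `R`, where `R > 0`: every point at distance less than
`R` from `A` has a unique closest point in `A`. -/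
structure HasReachAtLeast (A : Set F) (R : ℝ) : Prop where
  isClosed : IsClosed A
  pos : 0 < R
  existsUnique : ∀ y, Metric.infDist y A < R → ∃! a, a ∈ A ∧ dist y a = Metric.infDist y A

/-- A point of `A` closest to `y`; it is an arbitrary point if there is none. -/
def nearest (A : Set F) (y : F) : F :=
  Classical.epsilon fun a => a ∈ A ∧ dist y a = Metric.infDist y A

theorem infDist_le_norm_sub {a : F} (y : F) (ha : a ∈ A) : Metric.infDist y A ≤ ‖y - a‖ :=
  (Metric.infDist_le_dist_of_mem ha).trans_eq (dist_eq_norm y a)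

theorem infDist_le_add_norm_sub (A : Set F) (y z : F) :
    Metric.infDist y A ≤ Metric.infDist z A + ‖y - z‖ :=
  Metric.infDist_le_infDist_add_dist.trans_eq (by rw [dist_eq_norm])

namespace HasReachAtLeast

theorem nonempty (hA : HasReachAtLeast A R) : A.Nonempty := by
  by_contra h
  obtain ⟨a, ha, -⟩ := hA.existsUnique 0 (by
    rw [Set.not_nonempty_iff_eq_empty.1 h, Metric.infDist_empty]; exact hA.pos)
  exact h ⟨a, ha.1⟩

theorem nearest_spec (hA : HasReachAtLeast A R) {y : F} (hy : Metric.infDist y A < R) :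
    nearest A y ∈ A ∧ dist y (nearest A y) = Metric.infDist y A :=
  Classical.epsilon_spec (hA.existsUnique y hy).exists

theorem nearest_mem (hA : HasReachAtLeast A R) {y : F} (hy : Metric.infDist y A < R) :
    nearest A y ∈ A :=
  (hA.nearest_spec hy).1

theorem norm_sub_nearest (hA : HasReachAtLeast A R) {y : F} (hy : Metric.infDist y A < R) :
    ‖y - nearest A y‖ = Metric.infDist y A :=
  (dist_eq_norm _ _).symm.trans (hA.nearest_spec hy).2

theorem sub_nearest_ne_zero (hA : HasReachAtLeast A R) {y : F} (h0 : 0 < Metric.infDist y A)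
    (hy : Metric.infDist y A < R) : y - nearest A y ≠ 0 :=
  norm_pos_iff.1 (hA.norm_sub_nearest hy ▸ h0)

theorem eq_nearest (hA : HasReachAtLeast A R) {y a : F} (hy : Metric.infDist y A < R)
    (ha : a ∈ A) (h : ‖y - a‖ ≤ Metric.infDist y A) : a = nearest A y :=
  (hA.existsUnique y hy).unique
    ⟨ha, (dist_eq_norm y a).trans (h.antisymm (infDist_le_norm_sub y ha))⟩ (hA.nearest_spec hy)

theorem tendsto_nearest [ProperSpace F] (hA : HasReachAtLeast A R) {y : F}
    (hy : Metric.infDist y A < R) : Tendsto (nearest A) (𝓝 y) (𝓝 (nearest A y)) := by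
  have hR : ∀ᶠ z in 𝓝 y, Metric.infDist z A < R :=
    (Metric.continuous_infDist_pt A).continuousAt.eventually_lt_const hy
  have hball : ∀ ε > 0, ∀ᶠ z in 𝓝 y,
      nearest A z ∈ Metric.closedBall y (Metric.infDist y A + ε) := by
    intro ε hε
    have hlim : Tendsto (fun z => dist y z + Metric.infDist z A) (𝓝 y)
        (𝓝 (dist y y + Metric.infDist y A)) :=
      Continuous.tendsto (by fun_prop) y
    filter_upwards [hR, hlim.eventually_lt_const (u := Metric.infDist y A + ε) (by simpa)]
      with z hz hlt
    rw [← (hA.nearest_spec hz).2] at hlt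
    exact Metric.mem_closedBall'.2 ((dist_triangle y z _).trans hlt.le)
  refine (isCompact_closedBall y _).tendsto_nhds_of_unique_mapClusterPt (hball 1 one_pos)
    fun a _ ha => hA.eq_nearest hy ?_ (le_of_forall_pos_le_add fun ε hε => ?_)
  · exact hA.isClosed.mem_of_mapClusterPt ha (hR.mono fun z hz => hA.nearest_mem hz)
  · rw [← dist_eq_norm]
    exact Metric.mem_closedBall'.1 (Metric.isClosed_closedBall.mem_of_mapClusterPt ha (hball ε hε))

end HasReachAtLeast

end NearestPoints

/-! ### Normals extend -/

section Normals

variable {F : Type*} [NormedAddCommGroup F] [InnerProductSpace ℝ F] {A : Set F} {R : ℝ}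

theorem norm_smul_of_norm_eq_one {n : F} (hn : ‖n‖ = 1) {s : ℝ} (hs : 0 ≤ s) : ‖s • n‖ = s := by
  rw [norm_smul, hn, mul_one, Real.norm_of_nonneg hs]

theorem infDist_add_smul_le {a n : F} (ha : a ∈ A) (hn : ‖n‖ = 1) {s : ℝ} (hs : 0 ≤ s) :
    Metric.infDist (a + s • n) A ≤ s := by
  simpa [norm_smul_of_norm_eq_one hn hs] using infDist_le_norm_sub (a + s • n) ha

theorem infDist_add_smul_of_le {a n : F} (ha : a ∈ A) (hn : ‖n‖ = 1) {s t : ℝ} (hs : 0 ≤ s)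
    (hst : s ≤ t) (ht : Metric.infDist (a + t • n) A = t) : Metric.infDist (a + s • n) A = s := by
  refine le_antisymm (infDist_add_smul_le ha hn hs) ?_
  have h := infDist_le_add_norm_sub A (a + t • n) (a + s • n)
  rw [ht, add_sub_add_left_eq_sub, ← sub_smul,
    norm_smul_of_norm_eq_one hn (sub_nonneg.2 hst)] at h
  linarith

theorem eq_smul_of_add_le_norm {n u : F} (hn : ‖n‖ = 1) {t ε : ℝ} (ht : 0 < t) (hu : ‖u‖ ≤ ε)
    (h : t + ε ≤ ‖t • n + u‖) : u = ε • n := by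
  have htn : ‖t • n‖ = t := norm_smul_of_norm_eq_one hn ht.le
  have hle : ‖t • n + u‖ ≤ ‖t • n‖ + ‖u‖ := norm_add_le _ _
  have hray : SameRay ℝ (t • n) u := sameRay_iff_norm_add.2 (by linarith)
  rw [show ε = ‖u‖ by linarith]
  simpa [htn, smul_comm ‖u‖ t n, ht.ne'] using hray.norm_smul_eq

theorem norm_add_mul_lt_norm_add_smul {v w : F} {l h : ℝ} (hh : 0 < h) (hvw : l * ‖v‖ < ⟪v, w⟫) :
    ‖v‖ + l * h < ‖v + h • w‖ := by
  have hcs : ⟪v, v + h • w⟫ ≤ ‖v‖ * ‖v + h • w‖ := real_inner_le_norm _ _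
  rw [inner_add_right, real_inner_smul_right, real_inner_self_eq_norm_sq] at hcs
  have hv : 0 < ‖v‖ := norm_pos_iff.2 fun h0 => by simp [h0] at hvw
  refine lt_of_mul_lt_mul_left ?_ hv.le
  nlinarith

namespace HasReachAtLeast

theorem exists_eventually_add_mul_lt_infDist [ProperSpace F] (hA : HasReachAtLeast A R) {z : F}
    (hz0 : 0 < Metric.infDist z A) (hz : Metric.infDist z A < R) {l : ℝ} (hl : l < 1) :
    ∃ w : F, ‖w‖ = 1 ∧ ∀ᶠ h in 𝓝[>] (0 : ℝ),
      Metric.infDist z A + l * h < Metric.infDist (z + h • w) A := by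
  set v := z - nearest A z
  have hvz : ‖v‖ = Metric.infDist z A := hA.norm_sub_nearest hz
  have hv0 : v ≠ 0 := norm_pos_iff.1 (hvz ▸ hz0)
  refine ⟨‖v‖⁻¹ • v, norm_smul_inv_norm hv0, ?_⟩
  set w := ‖v‖⁻¹ • v
  have hz' : Tendsto (fun h : ℝ => z + h • w) (𝓝[>] 0) (𝓝 z) := by
    have : Continuous fun h : ℝ => z + h • w := by fun_prop
    simpa using (this.tendsto 0).mono_left nhdsWithin_le_nhds
  have hvlim : Tendsto (fun h : ℝ => z - nearest A (z + h • w)) (𝓝[>] 0) (𝓝 v) :=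
    tendsto_const_nhds.sub ((hA.tendsto_nearest hz).comp hz')
  have hslope : l * ‖v‖ < ⟪v, w⟫ := by
    rw [real_inner_smul_right, real_inner_self_eq_norm_mul_norm,
      inv_mul_cancel_left₀ (norm_ne_zero_iff.2 hv0)]
    exact mul_lt_of_lt_one_left (norm_pos_iff.2 hv0) hl
  filter_upwards [(hvlim.norm.const_mul l).eventually_lt (hvlim.inner tendsto_const_nhds) hslope,
    hz'.eventually ((Metric.continuous_infDist_pt A).continuousAt.eventually_lt_const hz),
    self_mem_nhdsWithin] with h hlt hR hh
  calc Metric.infDist z A + l * h ≤ ‖z - nearest A (z + h • w)‖ + l * h := by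
        gcongr; exact infDist_le_norm_sub z (hA.nearest_mem hR)
    _ < ‖z - nearest A (z + h • w) + h • w‖ := norm_add_mul_lt_norm_add_smul hh hlt
    _ = Metric.infDist (z + h • w) A := by rw [← hA.norm_sub_nearest hR]; congr 1; abel

/-- By the slope estimate, a maximiser of `infDist z A - l * ‖z - y‖` on the closed ball lies on
its sphere. -/
theorem exists_add_mul_le_infDist [ProperSpace F] (hA : HasReachAtLeast A R) {y : F}
    (hy : 0 < Metric.infDist y A) {ε l : ℝ} (hε : 0 ≤ ε) (hyR : Metric.infDist y A + ε < R)
    (hl0 : 0 ≤ l) (hl : l < 1) :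
    ∃ z ∈ Metric.closedBall y ε, Metric.infDist y A + l * ε ≤ Metric.infDist z A := by
  obtain ⟨z, hz, hmax⟩ := (isCompact_closedBall y ε).exists_isMaxOn
    (f := fun z => Metric.infDist z A - l * ‖z - y‖) ⟨y, Metric.mem_closedBall_self hε⟩
    (Continuous.continuousOn (by fun_prop))
  have hzy : Metric.infDist y A ≤ Metric.infDist z A - l * ‖z - y‖ := by
    simpa using hmax (Metric.mem_closedBall_self hε)
  rw [mem_closedBall_iff_norm] at hz
  suffices hzε : ‖z - y‖ = ε from ⟨z, mem_closedBall_iff_norm.2 hz, by rw [hzε] at hzy; linarith⟩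
  by_contra hne
  have hzε : 0 < ε - ‖z - y‖ := sub_pos.2 (lt_of_le_of_ne hz hne)
  have hz0 : 0 < Metric.infDist z A := by linarith [mul_nonneg hl0 (norm_nonneg (z - y))]
  have hzR : Metric.infDist z A < R := by linarith [infDist_le_add_norm_sub A z y]
  obtain ⟨w, hw, hgrow⟩ := hA.exists_eventually_add_mul_lt_infDist hz0 hzR hl
  obtain ⟨h, hlt, hh0, hhε⟩ := (hgrow.and (Ioo_mem_nhdsGT hzε)).exists
  have hnorm : ‖z + h • w - y‖ ≤ ‖z - y‖ + h := by
    rw [add_sub_right_comm]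
    exact (norm_add_le _ _).trans_eq (by rw [norm_smul_of_norm_eq_one hw hh0.le])
  have hle : Metric.infDist (z + h • w) A - l * ‖z + h • w - y‖ ≤ _ :=
    hmax (mem_closedBall_iff_norm.2 (by linarith))
  nlinarith [mul_le_mul_of_nonneg_left hnorm hl0]

theorem exists_add_le_infDist [ProperSpace F] (hA : HasReachAtLeast A R) {y : F}
    (hy : 0 < Metric.infDist y A) {ε : ℝ} (hε : 0 ≤ ε) (hyR : Metric.infDist y A + ε < R) :
    ∃ z ∈ Metric.closedBall y ε, Metric.infDist y A + ε ≤ Metric.infDist z A := by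
  obtain ⟨z, hz, hmax⟩ := (isCompact_closedBall y ε).exists_isMaxOn
    ⟨y, Metric.mem_closedBall_self hε⟩ (Metric.continuous_infDist_pt A).continuousOn
  refine ⟨z, hz, ?_⟩
  have hlim : Tendsto (fun l => Metric.infDist y A + l * ε) (𝓝[<] 1)
      (𝓝 (Metric.infDist y A + 1 * ε)) :=
    (Continuous.tendsto (by fun_prop) 1).mono_left nhdsWithin_le_nhds
  rw [one_mul] at hlim
  refine le_of_tendsto hlim ?_
  filter_upwards [Ico_mem_nhdsLT zero_lt_one] with l hl
  obtain ⟨z', hz', hle⟩ := hA.exists_add_mul_le_infDist hy hε hyR hl.1 hl.2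
  exact hle.trans (hmax hz')

theorem infDist_add_smul_of_infDist_eq [ProperSpace F] (hA : HasReachAtLeast A R) {a n : F}
    (ha : a ∈ A) (hn : ‖n‖ = 1) {s t : ℝ} (ht : 0 < t)
    (hat : Metric.infDist (a + t • n) A = t) (hs0 : 0 ≤ s) (hs : s < R) :
    Metric.infDist (a + s • n) A = s := by
  rcases le_total s t with hst | hts
  · exact infDist_add_smul_of_le ha hn hs0 hst hat
  obtain ⟨ε, hε, rfl⟩ : ∃ ε, 0 ≤ ε ∧ s = t + ε := ⟨s - t, sub_nonneg.2 hts, by ring⟩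
  obtain ⟨z, hz, hle⟩ := hA.exists_add_le_infDist (hat.symm ▸ ht) hε (by rwa [hat])
  rw [hat] at hle
  have hza : z = a + (t + ε) • n := by
    have hu : z - (a + t • n) = ε • n := by
      refine eq_smul_of_add_le_norm hn ht (mem_closedBall_iff_norm.1 hz)
        (hle.trans ((infDist_le_norm_sub z ha).trans_eq ?_))
      congr 1; abel
    rw [sub_eq_iff_eq_add'.1 hu, add_smul, add_assoc]
  exact (infDist_add_smul_le ha hn (by linarith)).antisymm (hza ▸ hle)

end HasReachAtLeast

theorem two_mul_inner_le_of_infDist_eq {a n b : F} (hb : b ∈ A) (hn : ‖n‖ = 1) {s : ℝ}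
    (hs : 0 ≤ s) (has : Metric.infDist (a + s • n) A = s) :
    2 * s * ⟪n, b - a⟫ ≤ ‖b - a‖ ^ 2 := by
  have h := pow_le_pow_left₀ hs (has.symm.trans_le (infDist_le_norm_sub _ hb)) 2
  rw [show a + s • n - b = s • n - (b - a) by abel, norm_sub_sq_real, real_inner_smul_left,
    norm_smul_of_norm_eq_one hn hs] at h
  linarith

end Normals

/-! ### Normals of sets of positive reach -/

section PolarNormals

variable {F : Type*} [NormedAddCommGroup F] [InnerProductSpace ℝ F] {A : Set F} {R : ℝ}

/-- The unit vector pointing from the nearest point of `A` to `y`, for `y ∉ A`. -/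
def outerNormal (A : Set F) (y : F) : F := NormedSpace.normalize (y - nearest A y)

theorem eq_zero_of_inner_nonpos_of_norm_sub_le {n w : F} (hin : ⟪n, w⟫ ≤ 0)
    (hle : ‖n - w‖ ≤ ‖n‖) : w = 0 := by
  have h := pow_le_pow_left₀ (norm_nonneg _) hle 2
  rw [norm_sub_sq_real] at h
  exact norm_eq_zero.1 (pow_eq_zero_iff two_ne_zero |>.1 (by linarith [sq_nonneg ‖w‖]))

theorem inner_nonpos_of_infDist_eq {a n b : F} (hn : ‖n‖ = 1) {s : ℝ} (hs : 0 < s)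
    (has : Metric.infDist (a + s • n) A = s) (hb : b ∈ tangentCone A a) : ⟪n, b⟫ ≤ 0 := by
  obtain ⟨α, l, hl, c, v, hv0, hvA, hcv⟩ := exists_fun_of_mem_tangentConeAt hb
  have hright : Tendsto (fun i => ‖c i • v i‖ * ‖v i‖ / (2 * s)) l (𝓝 0) := by
    simpa using (hcv.norm.mul hv0.norm).div_const (2 * s)
  refine le_of_tendsto_of_tendsto (tendsto_const_nhds.inner hcv) hright ?_
  filter_upwards [hvA] with i hi
  have h := two_mul_inner_le_of_infDist_eq hi hn hs.le has
  rw [add_sub_cancel_left] at h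
  rw [NNReal.smul_def, real_inner_smul_right, norm_smul, Real.norm_of_nonneg (c i).coe_nonneg,
    le_div_iff₀ (by positivity)]
  linarith [mul_le_mul_of_nonneg_left h (c i).coe_nonneg]

theorem mem_frontier_of_infDist_eq {a n : F} (ha : a ∈ A) (hn : ‖n‖ = 1) {s : ℝ} (hs : 0 < s)
    (has : Metric.infDist (a + s • n) A = s) : a ∈ frontier A := by
  refine ⟨subset_closure ha, fun hint => ?_⟩
  have hlim : Tendsto (fun t : ℝ => a + t • n) (𝓝[>] 0) (𝓝 a) := by
    have : Continuous fun t : ℝ => a + t • n := by fun_prop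
    simpa using (this.tendsto 0).mono_left nhdsWithin_le_nhds
  obtain ⟨t, htA, ht0, hts⟩ := ((hlim.eventually (mem_interior_iff_mem_nhds.1 hint)).and
    (Ioo_mem_nhdsGT hs)).exists
  exact ht0.ne ((Metric.infDist_zero_of_mem htA).symm.trans
    (infDist_add_smul_of_le ha hn ht0.le hts.le has))

namespace HasReachAtLeast

theorem nearest_add_infDist_smul_outerNormal (hA : HasReachAtLeast A R) {y : F}
    (hy : Metric.infDist y A < R) :
    nearest A y + Metric.infDist y A • outerNormal A y = y := by
  rw [← hA.norm_sub_nearest hy, outerNormal, NormedSpace.norm_smul_normalize, add_sub_cancel]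

theorem infDist_nearest_add_smul_outerNormal [ProperSpace F] (hA : HasReachAtLeast A R) {y : F}
    (h0 : 0 < Metric.infDist y A) (hy : Metric.infDist y A < R) {s : ℝ} (hs0 : 0 ≤ s)
    (hs : s < R) : Metric.infDist (nearest A y + s • outerNormal A y) A = s :=
  hA.infDist_add_smul_of_infDist_eq (hA.nearest_mem hy)
    (NormedSpace.norm_normalize (hA.sub_nearest_ne_zero h0 hy)) h0
    (congrArg (Metric.infDist · A) (hA.nearest_add_infDist_smul_outerNormal hy)) hs0 hs

theorem nearest_add_smul (hA : HasReachAtLeast A R) {a n : F} (ha : a ∈ A) (hn : ‖n‖ = 1) {s : ℝ}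
    (hs0 : 0 ≤ s) (hs : s < R) (has : Metric.infDist (a + s • n) A = s) :
    nearest A (a + s • n) = a :=
  (hA.eq_nearest (has.trans_lt hs) ha
    (by rw [has, add_sub_cancel_left, norm_smul_of_norm_eq_one hn hs0])).symm

/-- The cluster points of the difference quotients are tangent vectors at distance at most one
from `n`, so that polarity forces them to vanish. -/
theorem tendsto_slope_nearest_of_inner_nonpos [ProperSpace F] (hA : HasReachAtLeast A R) {a n : F}
    (ha : a ∈ A) (hn : ‖n‖ = 1) (hpol : ∀ w ∈ tangentCone A a, ⟪n, w⟫ ≤ 0) :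
    Tendsto (fun t : ℝ => t⁻¹ • (nearest A (a + t • n) - a)) (𝓝[>] 0) (𝓝 0) := by
  set q : ℝ → F := fun t => t⁻¹ • (nearest A (a + t • n) - a)
  have hsmall : ∀ᶠ t : ℝ in 𝓝[>] 0, t ∈ Set.Ioo 0 R := Ioo_mem_nhdsGT hA.pos
  have hR : ∀ t ∈ Set.Ioo 0 R, Metric.infDist (a + t • n) A < R := fun t ht =>
    (infDist_add_smul_le ha hn ht.1.le).trans_lt ht.2
  have hball : ∀ᶠ t in 𝓝[>] 0, q t ∈ Metric.closedBall n 1 := by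
    filter_upwards [hsmall] with t ht
    have hnq : n - q t = t⁻¹ • (a + t • n - nearest A (a + t • n)) := by
      rw [show a + t • n - nearest A (a + t • n) = t • n - (nearest A (a + t • n) - a) by abel,
        smul_sub, inv_smul_smul₀ ht.1.ne']
    rw [mem_closedBall_iff_norm', hnq, norm_smul, hA.norm_sub_nearest (hR t ht), norm_inv,
      Real.norm_of_nonneg ht.1.le, inv_mul_le_one₀ ht.1]
    exact infDist_add_smul_le ha hn ht.1.le
  refine (isCompact_closedBall n 1).tendsto_nhds_of_unique_mapClusterPt hball fun w hw hqw => ?_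
  refine eq_zero_of_inner_nonpos_of_norm_sub_le (hpol w ?_) (by
    rwa [hn, ← mem_closedBall_iff_norm'])
  obtain ⟨U, hU, hUw⟩ := mapClusterPt_iff_ultrafilter.1 hqw
  have hsub : ∀ᶠ t in (U : Filter ℝ), t • q t = nearest A (a + t • n) - a :=
    hU (hsmall.mono fun t ht => smul_inv_smul₀ ht.1.ne' _)
  have hU0 : Tendsto (fun t : ℝ => t) U (𝓝 0) :=
    tendsto_id.mono_left (hU.trans nhdsWithin_le_nhds)
  refine mem_tangentConeAt_of_seq (U : Filter ℝ) (fun t => t⁻¹.toNNReal)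
    (fun t => nearest A (a + t • n) - a) ?_ (hU (hsmall.mono fun t ht => ?_)) ?_
  · simpa using (hU0.smul hUw).congr' hsub
  · rw [add_sub_cancel]
    exact hA.nearest_mem (hR t ht)
  · refine hUw.congr' (hU (hsmall.mono fun t ht => ?_))
    simp only [q, NNReal.smul_def, Real.coe_toNNReal _ (inv_nonneg.2 ht.1.le)]

theorem infDist_add_smul_of_inner_nonpos [ProperSpace F] (hA : HasReachAtLeast A R) {a n : F}
    (ha : a ∈ A) (hn : ‖n‖ = 1) (hpol : ∀ w ∈ tangentCone A a, ⟪n, w⟫ ≤ 0) {s : ℝ} (hs0 : 0 ≤ s)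
    (hs : s < R) : Metric.infDist (a + s • n) A = s := by
  have hq := hA.tendsto_slope_nearest_of_inner_nonpos ha hn hpol
  set q : ℝ → F := fun t => t⁻¹ • (nearest A (a + t • n) - a)
  have hsmall : ∀ᶠ t : ℝ in 𝓝[>] 0, t ∈ Set.Ioo 0 R := Ioo_mem_nhdsGT hA.pos
  have hnq : Tendsto (fun t => n - q t) (𝓝[>] 0) (𝓝 n) := by simpa using hq.const_sub n
  have hsub : ∀ᶠ t in 𝓝[>] 0, a + t • n - nearest A (a + t • n) = t • (n - q t) := by
    filter_upwards [hsmall] with t ht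
    rw [smul_sub, smul_inv_smul₀ ht.1.ne']
    abel
  have hnormal : Tendsto (fun t : ℝ => outerNormal A (a + t • n)) (𝓝[>] 0) (𝓝 n) := by
    have h : Tendsto (fun t => NormedSpace.normalize (n - q t)) (𝓝[>] 0)
        (𝓝 (NormedSpace.normalize n)) :=
      (hnq.norm.inv₀ (by rw [hn]; exact one_ne_zero)).smul hnq
    rw [NormedSpace.normalize_eq_self_of_norm_eq_one hn] at h
    refine h.congr' ?_
    filter_upwards [hsmall, hsub] with t ht hsub
    rw [outerNormal, hsub, NormedSpace.normalize_smul_of_pos ht.1]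
  have hnearest : Tendsto (fun t : ℝ => nearest A (a + t • n)) (𝓝[>] 0) (𝓝 a) := by
    have h0 : Tendsto (fun t : ℝ => t) (𝓝[>] 0) (𝓝 0) := tendsto_id.mono_left nhdsWithin_le_nhds
    have h := (h0.smul hq).const_add a
    rw [smul_zero, add_zero] at h
    refine h.congr' ?_
    filter_upwards [hsmall] with t ht
    rw [smul_inv_smul₀ ht.1.ne', add_sub_cancel]
  refine tendsto_nhds_unique (((Metric.continuous_infDist_pt A).tendsto _).comp
    (hnearest.add (hnormal.const_smul s))) (tendsto_const_nhds.congr' ?_)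
  filter_upwards [hsmall, hsub, hnq.eventually_ne (norm_ne_zero_iff.1 (hn ▸ one_ne_zero))]
    with t ht hsub hne
  have hyR := (infDist_add_smul_le ha hn ht.1.le).trans_lt ht.2
  refine (hA.infDist_nearest_add_smul_outerNormal ?_ hyR hs0 hs).symm
  rw [← hA.norm_sub_nearest hyR, hsub]
  exact norm_pos_iff.2 (smul_ne_zero ht.1.ne' hne)

theorem two_mul_inner_outerNormal_le [ProperSpace F] (hA : HasReachAtLeast A R) {y b : F}
    (h0 : 0 < Metric.infDist y A) (hy : Metric.infDist y A < R) (hb : b ∈ A) :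
    2 * R * ⟪outerNormal A y, b - nearest A y⟫ ≤ ‖b - nearest A y‖ ^ 2 := by
  have hlim : Tendsto (fun s => 2 * s * ⟪outerNormal A y, b - nearest A y⟫) (𝓝[<] R)
      (𝓝 (2 * R * ⟪outerNormal A y, b - nearest A y⟫)) :=
    (Continuous.tendsto (by fun_prop) R).mono_left nhdsWithin_le_nhds
  refine le_of_tendsto hlim ?_
  filter_upwards [Ioo_mem_nhdsLT hA.pos] with s hs
  exact two_mul_inner_le_of_infDist_eq hb
    (NormedSpace.norm_normalize (hA.sub_nearest_ne_zero h0 hy)) hs.1.le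
    (hA.infDist_nearest_add_smul_outerNormal h0 hy hs.1.le hs.2)

theorem two_mul_inner_sub_nearest_le [ProperSpace F] (hA : HasReachAtLeast A R) {y b : F}
    (hy : Metric.infDist y A < R) (hb : b ∈ A) :
    2 * R * ⟪y - nearest A y, b - nearest A y⟫ ≤
      Metric.infDist y A * ‖b - nearest A y‖ ^ 2 := by
  have hsub : y - nearest A y = Metric.infDist y A • outerNormal A y :=
    sub_eq_iff_eq_add'.2 (hA.nearest_add_infDist_smul_outerNormal hy).symm
  rcases (Metric.infDist_nonneg (x := y) (s := A)).eq_or_lt with h0 | h0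
  · rw [hsub, ← h0, zero_smul, inner_zero_left, mul_zero, zero_mul]
  · rw [hsub, real_inner_smul_left, mul_left_comm]
    exact mul_le_mul_of_nonneg_left (hA.two_mul_inner_outerNormal_le h0 hy hb) h0.le

theorem norm_nearest_sub_nearest_le [ProperSpace F] (hA : HasReachAtLeast A R) {r : ℝ}
    (hr : r < R) {y z : F} (hy : Metric.infDist y A ≤ r) (hz : Metric.infDist z A ≤ r) :
    ‖nearest A y - nearest A z‖ ≤ R / (R - r) * ‖y - z‖ := by
  have hyz := hA.two_mul_inner_sub_nearest_le (hy.trans_lt hr) (hA.nearest_mem (hz.trans_lt hr))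
  have hzy := hA.two_mul_inner_sub_nearest_le (hz.trans_lt hr) (hA.nearest_mem (hy.trans_lt hr))
  set p := nearest A y
  set q := nearest A z
  rw [← neg_sub p q, inner_neg_right, norm_neg] at hyz
  have hdiff : ⟪y - p, p - q⟫ - ⟪z - q, p - q⟫ = ⟪y - z, p - q⟫ - ‖p - q‖ ^ 2 := by
    rw [← inner_sub_left, ← real_inner_self_eq_norm_sq, ← inner_sub_left]; congr 1; abel
  have hy' : Metric.infDist y A * ‖p - q‖ ^ 2 ≤ r * ‖p - q‖ ^ 2 := by gcongr
  have hz' : Metric.infDist z A * ‖p - q‖ ^ 2 ≤ r * ‖p - q‖ ^ 2 := by gcongr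
  have hcs : R * ⟪y - z, p - q⟫ ≤ R * (‖y - z‖ * ‖p - q‖) :=
    mul_le_mul_of_nonneg_left (real_inner_le_norm _ _) hA.pos.le
  rw [div_mul_eq_mul_div, le_div_iff₀ (sub_pos.2 hr)]
  rcases (norm_nonneg (p - q)).eq_or_lt with h0 | h0
  · rw [← h0, zero_mul]
    exact mul_nonneg hA.pos.le (norm_nonneg _)
  · refine le_of_mul_le_mul_right ?_ h0
    linarith [congrArg (R * ·) hdiff]

end HasReachAtLeast

end PolarNormals

section NormalBundle

variable {d : ℕ} {A : Set (E d)} {R : ℝ}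

theorem exists_hasReachAtLeast_of_lt_reach {r : ℝ} (hA : IsClosed A) (hr : 0 ≤ r)
    (h : ENNReal.ofReal r < reach A) : ∃ R, r < R ∧ HasReachAtLeast A R := by
  obtain ⟨t, ⟨s, rfl, hs⟩, hrs⟩ := lt_sSup_iff.1 h
  have hrs : r < s := (ENNReal.ofReal_lt_coe_iff hr).1 hrs
  exact ⟨s, hrs, hA, hr.trans_lt hrs, hs⟩

theorem mem_normalBundleOfReach_of_infDist_eq {a n : E d} (ha : a ∈ A) (hn : ‖n‖ = 1) {s : ℝ}
    (hs : 0 < s) (has : Metric.infDist (a + s • n) A = s) : (a, n) ∈ normalBundleOfReach A :=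
  ⟨mem_frontier_of_infDist_eq ha hn hs has,
    fun _ hb => inner_nonpos_of_infDist_eq hn hs has hb, hn⟩

namespace HasReachAtLeast

theorem reach_pos (hA : HasReachAtLeast A R) : 0 < reach A := by
  have hpos : (0 : ℝ≥0∞) < (R.toNNReal : ℝ≥0) := by simpa using hA.pos
  refine hpos.trans_le (le_sSup ⟨R.toNNReal, rfl, fun y hy => hA.existsUnique y ?_⟩)
  rwa [Real.coe_toNNReal _ hA.pos.le] at hy

theorem infDist_add_smul_of_mem_normalBundle (hA : HasReachAtLeast A R) {p : E d × E d}
    (hp : p ∈ normalBundleOfReach A) {s : ℝ} (hs0 : 0 ≤ s) (hs : s < R) :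
    Metric.infDist (p.1 + s • p.2) A = s :=
  hA.infDist_add_smul_of_inner_nonpos (hA.isClosed.frontier_subset hp.1) hp.2.2 hp.2.1 hs0 hs

theorem nearest_add_smul_of_mem_normalBundle (hA : HasReachAtLeast A R) {p : E d × E d}
    (hp : p ∈ normalBundleOfReach A) {s : ℝ} (hs0 : 0 ≤ s) (hs : s < R) :
    nearest A (p.1 + s • p.2) = p.1 :=
  hA.nearest_add_smul (hA.isClosed.frontier_subset hp.1) hp.2.2 hs0 hs
    (hA.infDist_add_smul_of_mem_normalBundle hp hs0 hs)

theorem mem_normalBundleOfReach_outerNormal (hA : HasReachAtLeast A R) {y : E d}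
    (h0 : 0 < Metric.infDist y A) (hy : Metric.infDist y A < R) :
    (nearest A y, outerNormal A y) ∈ normalBundleOfReach A :=
  mem_normalBundleOfReach_of_infDist_eq (hA.nearest_mem hy)
    (NormedSpace.norm_normalize (hA.sub_nearest_ne_zero h0 hy)) h0
    (by rw [hA.nearest_add_infDist_smul_outerNormal hy])

end HasReachAtLeast

end NormalBundle

/-! ### Tangent cones -/

section TangentCone

variable {V W : Type*} [NormedAddCommGroup V] [NormedSpace ℝ V] [NormedAddCommGroup W]
  [NormedSpace ℝ W]

theorem apply_mem_tangentCone_of_hasFDerivWithinAt {φ : V → W} {φ' : V →L[ℝ] W} {N : Set V}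
    {M : Set W} {p v : V} (hφ : HasFDerivWithinAt φ φ' N p) (hNM : Set.MapsTo φ N M)
    (hv : v ∈ tangentCone N p) : φ' v ∈ tangentCone M (φ p) := by
  obtain ⟨ι, l, hl, c, u, hu0, hu, hcu⟩ := exists_fun_of_mem_tangentConeAt hv
  refine mem_tangentConeAt_of_seq l c (fun i => φ (p + u i) - φ p) ?_ ?_ ?_
  · rw [tendsto_sub_nhds_zero_iff]
    exact hφ.continuousWithinAt.tendsto.comp
      (tendsto_nhdsWithin_iff.2 ⟨by simpa using hu0.const_add p, hu⟩)
  · filter_upwards [hu] with i hi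
    rw [add_sub_cancel]
    exact hNM hi
  · exact hφ.lim hu0 hu hcu

theorem norm_apply_le_of_mem_tangentCone {φ ψ : V →L[ℝ] W} {N : Set V} {p v : V} {C : ℝ}
    (h : ∀ q ∈ N, ‖φ (q - p)‖ ≤ C * ‖ψ (q - p)‖) (hv : v ∈ tangentCone N p) :
    ‖φ v‖ ≤ C * ‖ψ v‖ := by
  obtain ⟨ι, l, hl, c, u, -, hu, hcu⟩ := exists_fun_of_mem_tangentConeAt hv
  refine le_of_tendsto_of_tendsto ((φ.continuous.tendsto v).comp hcu).norm
    (((ψ.continuous.tendsto v).comp hcu).norm.const_mul C) ?_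
  filter_upwards [hu] with i hi
  have hle := h _ hi
  rw [add_sub_cancel_left] at hle
  simp only [Function.comp_apply, NNReal.smul_def, map_smul, norm_smul,
    Real.norm_of_nonneg (c i).coe_nonneg]
  rw [mul_left_comm]
  exact mul_le_mul_of_nonneg_left hle (c i).coe_nonneg

theorem tangentCone_singleton (v : V) : tangentCone {v} v = {0} := by
  refine Set.Subset.antisymm (fun w hw => ?_) ?_
  · have h := norm_apply_le_of_mem_tangentCone (φ := .id ℝ V) (ψ := 0) (C := 0)
      (by rintro _ rfl; simp) hw
    simpa using h
  · rintro _ rfl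
    exact zero_mem_tangentConeAt (subset_closure rfl)

theorem span_tangentCone_eq_top_of_convex_subset {s B : Set V} {y : V} (hs : Convex ℝ s)
    (hint : (interior s).Nonempty) (hy : y ∈ s) (hsB : s ⊆ B) :
    Submodule.span ℝ (tangentCone B y) = ⊤ := by
  have hsub : (· - y) '' s ⊆ Submodule.span ℝ (tangentCone B y) := by
    rintro _ ⟨z, hz, rfl⟩
    exact Submodule.subset_span (sub_mem_posTangentConeAt_of_openSegment_subset
      ((hs.openSegment_subset hy hz).trans hsB))
  refine (Submodule.span ℝ (tangentCone B y)).eq_top_of_nonempty_interior' ?_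
  have himage : (interior ((· - y) '' s)).Nonempty :=
    (hint.image _).mono ((Homeomorph.subRight y).image_interior s).subset
  exact himage.mono (interior_mono hsub)

end TangentCone

/-! ### Offsets of sets of positive reach -/

section Offsets

open Metric (infDist)

section NormedSpace

variable {F : Type*} [NormedAddCommGroup F] {A : Set F} {r : ℝ} {y : F}

theorem mem_cthickening_iff_infDist_le (hA : A.Nonempty) (hr : 0 ≤ r) :
    y ∈ Metric.cthickening r A ↔ infDist y A ≤ r := by
  rw [Metric.mem_cthickening_iff, infDist,
    ENNReal.le_ofReal_iff_toReal_le (Metric.infEDist_ne_top hA) hr]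

theorem infDist_cthickening [NormedSpace ℝ F] (hA : A.Nonempty) (hr : 0 ≤ r)
    (hy : r ≤ infDist y A) : infDist y (Metric.cthickening r A) = infDist y A - r := by
  have hfin := Metric.infEDist_ne_top hA (x := y)
  rw [infDist, infEDist_cthickening,
    ENNReal.toReal_sub_of_le ((ENNReal.ofReal_le_iff_le_toReal hfin).2 hy) hfin,
    ENNReal.toReal_ofReal hr, infDist]

end NormedSpace

namespace HasReachAtLeast

variable {F : Type*} [NormedAddCommGroup F] [InnerProductSpace ℝ F] {A : Set F} {R r : ℝ}

theorem existsUnique_cthickening (hA : HasReachAtLeast A R) (hr : 0 < r) {y : F}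
    (hry : r < infDist y A) (hy : infDist y A < R) :
    ∃! a, a ∈ Metric.cthickening r A ∧ dist y a = infDist y (Metric.cthickening r A) := by
  have hD : 0 < infDist y A := hr.trans hry
  have hp : dist (nearest A y) y = infDist y A := by
    rw [dist_comm, (hA.nearest_spec hy).2]
  rw [infDist_cthickening hA.nonempty hr.le hry.le]
  simp only [mem_cthickening_iff_infDist_le hA.nonempty hr.le]
  refine ⟨AffineMap.lineMap (nearest A y) y (r / infDist y A), ⟨?_, ?_⟩, ?_⟩
  · refine (Metric.infDist_le_dist_of_mem (hA.nearest_mem hy)).trans_eq ?_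
    rw [dist_lineMap_left, hp, Real.norm_of_nonneg (by positivity), div_mul_cancel₀ _ hD.ne']
  · rw [dist_comm, dist_lineMap_right, hp,
      Real.norm_of_nonneg (sub_nonneg.2 ((div_le_one hD).2 hry.le)), sub_mul, one_mul,
      div_mul_cancel₀ _ hD.ne']
  · rintro q ⟨hqA, hyq⟩
    have hq := hA.nearest_spec (hqA.trans_lt (hry.trans hy))
    have htri : dist y (nearest A q) ≤ dist y q + dist q (nearest A q) := dist_triangle _ _ _
    have hqy : nearest A q = nearest A y :=
      hA.eq_nearest hy hq.1 (by rw [← dist_eq_norm]; linarith)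
    have hle : infDist y A ≤ dist y (nearest A q) := Metric.infDist_le_dist_of_mem hq.1
    rw [hqy] at hq htri hle
    refine eq_lineMap_of_dist_eq_mul_of_dist_eq_mul ?_ ?_
    · rw [hp, div_mul_cancel₀ _ hD.ne', dist_comm]
      linarith
    · rw [hp, sub_mul, one_mul, div_mul_cancel₀ _ hD.ne', dist_comm, hyq]

protected theorem cthickening (hA : HasReachAtLeast A R) (hr : 0 < r) (hrR : r < R) :
    HasReachAtLeast (Metric.cthickening r A) (R - r) where
  isClosed := Metric.isClosed_cthickening
  pos := sub_pos.2 hrR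
  existsUnique y hy := by
    rcases le_or_gt (infDist y A) r with hle | hlt
    · have hyA := (mem_cthickening_iff_infDist_le hA.nonempty hr.le).2 hle
      rw [Metric.infDist_zero_of_mem hyA]
      exact ⟨y, ⟨hyA, dist_self y⟩, fun z hz => (dist_eq_zero.1 hz.2).symm⟩
    · rw [infDist_cthickening hA.nonempty hr.le hlt.le] at hy
      exact hA.existsUnique_cthickening hr hlt (by linarith)

theorem sub_smul_mem_of_infDist_cthickening (hA : HasReachAtLeast A R) (hr : 0 ≤ r) (hrR : r < R)
    {y n : F} (hn : ‖n‖ = 1) (hy : y ∈ Metric.cthickening r A) {s : ℝ} (hs : 0 < s)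
    (hys : infDist (y + s • n) (Metric.cthickening r A) = s) :
    y - r • n ∈ A ∧ infDist (y + s • n) A = r + s := by
  have hlt : r < infDist (y + s • n) A := by
    by_contra! hle
    rw [Metric.infDist_zero_of_mem ((mem_cthickening_iff_infDist_le hA.nonempty hr).2 hle)] at hys
    exact hs.ne hys
  rw [infDist_cthickening hA.nonempty hr hlt.le] at hys
  rw [mem_cthickening_iff_infDist_le hA.nonempty hr] at hy
  have hyn : y - nearest A y = r • n := by
    refine eq_smul_of_add_le_norm hn hs ((hA.norm_sub_nearest (hy.trans_lt hrR)).trans_le hy) ?_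
    calc s + r = infDist (y + s • n) A := by linarith
      _ ≤ ‖y + s • n - nearest A y‖ :=
        infDist_le_norm_sub _ (hA.nearest_mem (hy.trans_lt hrR))
      _ = ‖s • n + (y - nearest A y)‖ := by congr 1; abel
  rw [← hyn, sub_sub_cancel]
  exact ⟨hA.nearest_mem (hy.trans_lt hrR), by linarith⟩

end HasReachAtLeast

variable {d : ℕ} {A : Set (E d)} {R r : ℝ}

theorem isFullyDimensional_cthickening (hA : IsClosed A) (hne : A.Nonempty) (hr : 0 < r) :
    IsFullyDimensional (Metric.cthickening r A) := by
  intro y hy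
  obtain ⟨a, ha, hay⟩ := hA.exists_infDist_eq_dist hne y
  have hyr : infDist y A ≤ r :=
    (mem_cthickening_iff_infDist_le hne hr.le).1 (Metric.isClosed_cthickening.frontier_subset hy)
  refine span_tangentCone_eq_top_of_convex_subset (convex_closedBall a r) ?_
    (Metric.mem_closedBall.2 (hay ▸ hyr)) (Metric.closedBall_subset_cthickening ha r)
  rw [interior_closedBall a hr.ne']
  exact Metric.nonempty_ball.2 hr

theorem HasReachAtLeast.normalBundleOfReach_cthickening (hA : HasReachAtLeast A R) (hr : 0 < r)
    (hrR : r < R) : normalBundleOfReach (Metric.cthickening r A) =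
      {p | (p.1 - r • p.2, p.2) ∈ normalBundleOfReach A} := by
  have hB := hA.cthickening hr hrR
  obtain ⟨s, hs0, hs⟩ := exists_between hB.pos
  ext ⟨y, n⟩
  constructor
  · intro hp
    obtain ⟨hmem, hdist⟩ := hA.sub_smul_mem_of_infDist_cthickening hr.le hrR hp.2.2
      (hB.isClosed.frontier_subset hp.1) hs0 (hB.infDist_add_smul_of_mem_normalBundle hp hs0.le hs)
    refine mem_normalBundleOfReach_of_infDist_eq hmem hp.2.2 (add_pos hr hs0) ?_
    rwa [add_smul, ← add_assoc, sub_add_cancel]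
  · intro hp
    have hdist : ∀ t, 0 ≤ t → t < R → infDist (y - r • n + t • n) A = t :=
      fun t => hA.infDist_add_smul_of_mem_normalBundle hp
    have hy := hdist r hr.le hrR
    rw [sub_add_cancel] at hy
    have hys := hdist (r + s) (by linarith) (by linarith)
    rw [add_smul, ← add_assoc, sub_add_cancel] at hys
    refine mem_normalBundleOfReach_of_infDist_eq
      ((mem_cthickening_iff_infDist_le hA.nonempty hr.le).2 hy.le) hp.2.2 hs0 ?_
    rw [infDist_cthickening hA.nonempty hr.le (by linarith), hys, add_sub_cancel_left]

end Offsets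

/-! ### The normal bundles of a set and of its erosions -/

section OffsetMap

variable {d : ℕ}

/-- The involution `(a, n) ↦ (a + r n, -n)`, which carries the unit normals of the `r`-erosion of a
set to those of its closed complement: a boundary point `y` of the erosion lies at distance `r` from
the closed complement, and the two sets lie on opposite sides of `y`. -/
def offsetMap (r : ℝ) : (E d × E d) →L[ℝ] (E d × E d) :=
  (ContinuousLinearMap.fst ℝ (E d) (E d) + r • ContinuousLinearMap.snd ℝ (E d) (E d)).prod
    (-ContinuousLinearMap.snd ℝ (E d) (E d))

@[simp]
theorem offsetMap_apply (r : ℝ) (p : E d × E d) : offsetMap r p = (p.1 + r • p.2, -p.2) := rfl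

theorem offsetMap_offsetMap (r : ℝ) (p : E d × E d) : offsetMap r (offsetMap r p) = p := by
  simp

theorem tangentCone_preimage_offsetMap (r : ℝ) (N : Set (E d × E d)) (p : E d × E d) :
    tangentCone (offsetMap r ⁻¹' N) p = offsetMap r ⁻¹' tangentCone N (offsetMap r p) := by
  have hderiv := fun s p => (offsetMap r (d := d)).hasFDerivAt.hasFDerivWithinAt (s := s) (x := p)
  refine Set.Subset.antisymm (fun v hv => apply_mem_tangentCone_of_hasFDerivWithinAt (hderiv _ p)
    (Set.mapsTo_preimage _ _) hv) fun v hv => ?_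
  have h := apply_mem_tangentCone_of_hasFDerivWithinAt (hderiv N (offsetMap r p))
    (M := offsetMap r ⁻¹' N) (fun q hq => by rwa [Set.mem_preimage, offsetMap_offsetMap]) hv
  rwa [offsetMap_offsetMap, offsetMap_offsetMap] at h

end OffsetMap

section Erosion

variable {d : ℕ} {X : Set (E d)} {R r : ℝ}

theorem mem_normalBundle_iff {p : E d × E d} : p ∈ normalBundle X ↔
    p.1 ∈ frontier X ∧ -p.2 ∈ normalConeOfReach (closedCompl X) p.1 ∧ ‖p.2‖ = 1 := by
  refine and_congr_right fun h => ?_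
  rw [normalCone, if_neg h.2]
  rfl

theorem frontier_closedCompl_subset (X : Set (E d)) : frontier (closedCompl X) ⊆ frontier X :=
  frontier_closure_subset.trans (frontier_compl X).subset

theorem normalBundle_eq_preimage (hX : HasReachAtLeast (closedCompl X) R) :
    normalBundle X = offsetMap 0 ⁻¹' normalBundleOfReach (closedCompl X) := by
  ext p
  rw [mem_normalBundle_iff, Set.mem_preimage, offsetMap_apply, zero_smul, add_zero]
  constructor
  · rintro ⟨hfr, hnor, hn⟩
    rw [← norm_neg] at hn
    have hmem : p.1 ∈ closedCompl X := by
      rw [← frontier_compl] at hfr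
      exact frontier_subset_closure hfr
    obtain ⟨s, hs0, hs⟩ := exists_between hX.pos
    exact mem_normalBundleOfReach_of_infDist_eq hmem hn hs0
      (hX.infDist_add_smul_of_inner_nonpos hmem hn hnor hs0.le hs)
  · rintro ⟨hfr, hnor, hn⟩
    exact ⟨frontier_closedCompl_subset X hfr, hnor, by rwa [norm_neg] at hn⟩

theorem closedCompl_erosion (hne : (closedCompl X).Nonempty) (hr : 0 < r) :
    closedCompl (erosion X r) = Metric.cthickening r (closedCompl X) := by
  have hcompl : (erosion X r)ᶜ = Metric.thickening r (closedCompl X) := by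
    ext y
    simp [erosion, Metric.mem_thickening_iff_infDist_lt hne]
  rw [closedCompl, hcompl, closure_thickening hr]

theorem admitsNormalBundle_erosion (hX : HasReachAtLeast (closedCompl X) R) (hr : 0 < r)
    (hrR : r < R) : AdmitsNormalBundle (erosion X r) := by
  rw [AdmitsNormalBundle, closedCompl_erosion hX.nonempty hr]
  exact ⟨(hX.cthickening hr hrR).reach_pos,
    isFullyDimensional_cthickening hX.isClosed hX.nonempty hr⟩

theorem normalBundle_erosion_eq_preimage (hX : HasReachAtLeast (closedCompl X) R) (hr : 0 < r)
    (hrR : r < R) :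
    normalBundle (erosion X r) = offsetMap r ⁻¹' normalBundleOfReach (closedCompl X) := by
  have hcompl := closedCompl_erosion hX.nonempty hr
  have hreach : HasReachAtLeast (closedCompl (erosion X r)) (R - r) :=
    hcompl ▸ hX.cthickening hr hrR
  ext p
  rw [normalBundle_eq_preimage hreach, hcompl, hX.normalBundleOfReach_cthickening hr hrR]
  simp [sub_eq_add_neg]

end Erosion

/-! ### Tangent vectors of the normal bundle -/

section HasFDerivAt

open Metric (infDist)

theorem hasFDerivAt_of_tangentCone_graphOn {V W : Type*} [NormedAddCommGroup V] [NormedSpace ℝ V]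
    [ProperSpace V] [NormedAddCommGroup W] [NormedSpace ℝ W] [ProperSpace W] {g : V → W}
    {L : V →L[ℝ] W} {x : V} {U : Set V} {C : ℝ} (hU : U ∈ 𝓝 x)
    (hg : ∀ᶠ y in 𝓝 x, ‖g y - g x‖ ≤ C * ‖y - x‖)
    (hL : ∀ w ∈ tangentCone (U.graphOn g) (x, g x), L w.1 = w.2) : HasFDerivAt g L x := by
  rw [hasFDerivAt_iff_tendsto]
  refine tendsto_of_subseq_tendsto fun y hy => ?_
  have hgx : Tendsto g (𝓝 x) (𝓝 (g x)) := by
    rw [tendsto_iff_norm_sub_tendsto_zero]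
    refine squeeze_zero' (.of_forall fun _ => norm_nonneg _) hg ?_
    have hsub := (tendsto_iff_norm_sub_tendsto_zero.1 (tendsto_id (x := 𝓝 x))).const_mul C
    rwa [mul_zero] at hsub
  have hbounded : ∀ᶠ k in atTop, ‖y k - x‖⁻¹ • (y k - x, g (y k) - g x) ∈
      Metric.closedBall (0 : V × W) (max 1 C) := by
    filter_upwards [hy.eventually hg] with k hk
    rw [mem_closedBall_zero_iff, norm_smul, norm_inv, norm_norm]
    refine inv_mul_le_of_le_mul₀ (norm_nonneg _) (by positivity) (norm_prod_le_iff.2 ⟨?_, ?_⟩)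
    · exact le_mul_of_one_le_right (norm_nonneg _) (le_max_left _ _)
    · rw [mul_comm]
      exact hk.trans (mul_le_mul_of_nonneg_right (le_max_right _ _) (norm_nonneg _))
  obtain ⟨w, -, ξ, hξ, hlim⟩ :=
    (isCompact_closedBall (0 : V × W) (max 1 C)).tendsto_subseq' hbounded.frequently
  have hyξ := hy.comp hξ.tendsto_atTop
  have hw : w ∈ tangentCone (U.graphOn g) (x, g x) := by
    refine mem_tangentConeAt_of_seq atTop (fun k => ‖y (ξ k) - x‖₊⁻¹)
      (fun k => (y (ξ k) - x, g (y (ξ k)) - g x)) ?_ ?_ hlim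
    · have hpair := (hyξ.sub_const x).prodMk_nhds ((hgx.comp hyξ).sub_const (g x))
      rwa [sub_self, sub_self] at hpair
    · filter_upwards [hyξ.eventually hU] with k hk
      rw [Prod.mk_add_mk, add_sub_cancel, add_sub_cancel]
      exact ⟨_, hk, rfl⟩
  refine ⟨ξ, ?_⟩
  have hfin := (((continuous_snd.tendsto w).comp hlim).sub
    (((L.continuous.comp continuous_fst).tendsto w).comp hlim)).norm
  rw [Function.comp_apply, hL w hw, sub_self, norm_zero] at hfin
  refine hfin.congr fun k => ?_
  simp only [Function.comp_apply, Prod.smul_fst, Prod.smul_snd, map_smul]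
  rw [← smul_sub, norm_smul, norm_inv, norm_norm]

variable {F : Type*} [NormedAddCommGroup F] [InnerProductSpace ℝ F]

theorem exists_hasFDerivAt_normalize {x : F} (hx : x ≠ 0) :
    ∃ D : F →L[ℝ] F, HasFDerivAt NormedSpace.normalize D x ∧
      ∀ v, ∃ t : ℝ, ‖x‖ • D v + t • NormedSpace.normalize x = v := by
  have hnorm : DifferentiableAt ℝ (fun z : F => ‖z‖) x := differentiableAt_id.norm ℝ hx
  have hnormalize : DifferentiableAt ℝ (NormedSpace.normalize : F → F) x :=
    (hnorm.inv (norm_ne_zero_iff.2 hx)).smul differentiableAt_id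
  refine ⟨_, hnormalize.hasFDerivAt, fun v => ⟨fderiv ℝ (fun z : F => ‖z‖) x v, ?_⟩⟩
  have hid := hnorm.hasFDerivAt.fun_smul hnormalize.hasFDerivAt
  simp only [NormedSpace.norm_smul_normalize] at hid
  exact DFunLike.congr_fun (hid.unique (hasFDerivAt_id x)) v

variable [ProperSpace F] {A : Set F} {R : ℝ}

namespace HasReachAtLeast

theorem hasFDerivAt_infDist_sq (hA : HasReachAtLeast A R) {y : F} (hy : infDist y A < R) :
    HasFDerivAt (fun z => infDist z A ^ 2) (innerSL ℝ ((2 : ℝ) • (y - nearest A y))) y := by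
  have hlim : Tendsto (fun z => ‖z - y‖ + 2 * ‖nearest A z - nearest A y‖) (𝓝 y) (𝓝 0) := by
    have h := (tendsto_iff_norm_sub_tendsto_zero.1 tendsto_id).add
      ((tendsto_iff_norm_sub_tendsto_zero.1 (hA.tendsto_nearest hy)).const_mul 2)
    rwa [mul_zero, add_zero] at h
  rw [hasFDerivAt_iff_isLittleO, Asymptotics.isLittleO_iff]
  intro c hc
  filter_upwards [hlim.eventually_le_const hc,
    (Metric.continuous_infDist_pt A).continuousAt.eventually_lt_const hy] with z hz hzR
  have hupper : infDist z A ^ 2 ≤ ‖z - y‖ ^ 2 + 2 * ⟪y - nearest A y, z - y⟫ + infDist y A ^ 2 := by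
    rw [← hA.norm_sub_nearest hy, real_inner_comm, ← norm_add_sq_real, sub_add_sub_cancel]
    exact pow_le_pow_left₀ Metric.infDist_nonneg (infDist_le_norm_sub _ (hA.nearest_mem hy)) 2
  have hlower : infDist y A ^ 2 ≤ ‖z - y‖ ^ 2 - 2 * ⟪z - nearest A z, z - y⟫ + infDist z A ^ 2 := by
    rw [← hA.norm_sub_nearest hzR, real_inner_comm, norm_sub_rev, ← neg_sub y z, inner_neg_left,
      mul_neg, sub_neg_eq_add, ← norm_add_sq_real, sub_add_sub_cancel]
    exact pow_le_pow_left₀ Metric.infDist_nonneg (infDist_le_norm_sub _ (hA.nearest_mem hzR)) 2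
  have hcs := real_inner_le_norm (nearest A z - nearest A y) (z - y)
  have hsplit : ⟪z - nearest A z, z - y⟫ = ⟪y - nearest A y, z - y⟫ + ‖z - y‖ ^ 2 -
      ⟪nearest A z - nearest A y, z - y⟫ := by
    rw [← real_inner_self_eq_norm_sq, ← inner_add_left, ← inner_sub_left]
    congr 1
    abel
  have hbound := mul_le_mul_of_nonneg_right hz (norm_nonneg (z - y))
  rw [innerSL_apply_apply, real_inner_smul_left, Real.norm_eq_abs, abs_le]
  constructor <;>
    nlinarith [mul_nonneg (norm_nonneg (nearest A z - nearest A y)) (norm_nonneg (z - y))]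

theorem inner_apply_comm_of_hasFDerivAt_nearest (hA : HasReachAtLeast A R) {y : F}
    (hy : infDist y A < R) {L : F →L[ℝ] F} (hL : HasFDerivAt (nearest A) L y) (v w : F) :
    ⟪L v, w⟫ = ⟪L w, v⟫ := by
  have hgrad : ∀ᶠ z in 𝓝 y,
      HasFDerivAt (fun z => infDist z A ^ 2) (innerSL ℝ ((2 : ℝ) • (z - nearest A z))) z :=
    ((Metric.continuous_infDist_pt A).continuousAt.eventually_lt_const hy).mono
      fun z hz => hA.hasFDerivAt_infDist_sq hz
  have hsymm := second_derivative_symmetric_of_eventually hgrad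
    ((innerSL ℝ).hasFDerivAt.comp y (((hasFDerivAt_id y).sub hL).const_smul (2 : ℝ))) v w
  change ⟪(2 : ℝ) • (v - L v), w⟫ = ⟪(2 : ℝ) • (w - L w), v⟫ at hsymm
  rw [real_inner_smul_left, real_inner_smul_left, inner_sub_left, inner_sub_left,
    real_inner_comm] at hsymm
  linarith

end HasReachAtLeast

end HasFDerivAt

section RegularPair

variable {d : ℕ} {N : Set (E d × E d)} {p : E d × E d}

theorem IsRegularPair.coe_tangentSpace (h : IsRegularPair N p) :
    (tangentSpace N p : Set (E d × E d)) = tangentCone N p := by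
  obtain ⟨T, hT, -⟩ := h.2
  rw [tangentSpace, ← hT, Submodule.span_eq]

theorem IsRegularPair.finrank_tangentSpace (h : IsRegularPair N p) :
    Module.finrank ℝ (tangentSpace N p) + 1 = d := by
  obtain ⟨T, hT, hdim⟩ := h.2
  rwa [tangentSpace, ← hT, Submodule.span_eq]

theorem IsRegularPair.mem_tangentCone (h : IsRegularPair N p) {w : E d × E d}
    (hw : w ∈ tangentSpace N p) : w ∈ tangentCone N p :=
  h.coe_tangentSpace.subset hw

end RegularPair

section TangentVectors

open Metric (infDist)

variable {d : ℕ} {A : Set (E d)} {R r : ℝ} {p w : E d × E d}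

theorem inner_snd_eq_zero_of_mem_tangentCone (hp : ‖p.2‖ = 1)
    (hw : w ∈ tangentCone (normalBundleOfReach A) p) : ⟪p.2, w.2⟫ = 0 := by
  have hder : HasFDerivAt (fun q : E d × E d => ‖q.2‖ ^ 2) _ p := hasFDerivAt_snd.norm_sq
  have hmaps : Set.MapsTo (fun q : E d × E d => ‖q.2‖ ^ 2) (normalBundleOfReach A) {‖p.2‖ ^ 2} :=
    fun q hq => by simp only [hq.2.2, hp, Set.mem_singleton_iff]
  have h := apply_mem_tangentCone_of_hasFDerivWithinAt hder.hasFDerivWithinAt hmaps hw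
  rw [tangentCone_singleton, Set.mem_singleton_iff] at h
  simpa using h

namespace HasReachAtLeast

theorem inner_fst_eq_zero_of_mem_tangentCone (hA : HasReachAtLeast A R)
    (hp : p ∈ normalBundleOfReach A) (hw : w ∈ tangentCone (normalBundleOfReach A) p) :
    ⟪p.2, w.1⟫ = 0 := by
  obtain ⟨s, hs, hsR⟩ := exists_between hA.pos
  have hdist : ∀ q ∈ normalBundleOfReach A, infDist (q.1 + s • q.2) A = s := fun q hq =>
    hA.infDist_add_smul_of_mem_normalBundle hq hs.le hsR
  have hder := (hA.hasFDerivAt_infDist_sq ((hdist p hp).trans_lt hsR)).comp p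
    (hasFDerivAt_fst.fun_add (hasFDerivAt_snd.fun_const_smul s))
  have hmaps : Set.MapsTo ((fun z => infDist z A ^ 2) ∘ fun q : E d × E d => q.1 + s • q.2)
      (normalBundleOfReach A) {infDist (p.1 + s • p.2) A ^ 2} := fun q hq => by
    simp only [Function.comp_apply, hdist q hq, hdist p hp, Set.mem_singleton_iff]
  have h := apply_mem_tangentCone_of_hasFDerivWithinAt hder.hasFDerivWithinAt hmaps hw
  rw [Function.comp_apply, tangentCone_singleton, Set.mem_singleton_iff,
    hA.nearest_add_smul_of_mem_normalBundle hp hs.le hsR, add_sub_cancel_left] at h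
  simpa [real_inner_smul_left, inner_add_right, inner_smul_right, hs.ne',
    inner_snd_eq_zero_of_mem_tangentCone hp.2.2 hw] using h

theorem eq_zero_of_mem_tangentCone (hA : HasReachAtLeast A R) (hp : p ∈ normalBundleOfReach A)
    (hr : 0 < r) (hrR : r < R) (hw : w ∈ tangentCone (normalBundleOfReach A) p)
    (h0 : w.1 + r • w.2 = 0) : w = 0 := by
  have hlip : ∀ q ∈ normalBundleOfReach A,
      ‖q.1 - p.1‖ ≤ R / (R - r) * ‖q.1 - p.1 + r • (q.2 - p.2)‖ := fun q hq => by
    have h := hA.norm_nearest_sub_nearest_le hrR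
      (hA.infDist_add_smul_of_mem_normalBundle hq hr.le hrR).le
      (hA.infDist_add_smul_of_mem_normalBundle hp hr.le hrR).le
    rwa [hA.nearest_add_smul_of_mem_normalBundle hq hr.le hrR,
      hA.nearest_add_smul_of_mem_normalBundle hp hr.le hrR, add_sub_add_comm, ← smul_sub] at h
  have hle : ‖w.1‖ ≤ R / (R - r) * ‖w.1 + r • w.2‖ :=
    norm_apply_le_of_mem_tangentCone (φ := ContinuousLinearMap.fst ℝ (E d) (E d))
      (ψ := ContinuousLinearMap.fst ℝ (E d) (E d) + r • ContinuousLinearMap.snd ℝ (E d) (E d))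
      hlip hw
  rw [h0, norm_zero, mul_zero, norm_le_zero_iff] at hle
  rw [hle, zero_add, smul_eq_zero] at h0
  exact Prod.ext hle (h0.resolve_left hr.ne')

theorem exists_mem_tangentCone_of_graphOn_nearest (hA : HasReachAtLeast A R) (hp : ‖p.2‖ = 1)
    (hr : 0 < r) (hw : w ∈ tangentCone ({y | 0 < infDist y A ∧ infDist y A < R}.graphOn (nearest A))
      (p.1 + r • p.2, p.1)) :
    ∃ (v : E d) (t : ℝ), (w.2, v) ∈ tangentCone (normalBundleOfReach A) p ∧
      w.2 + r • v + t • p.2 = w.1 := by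
  have hsub : p.1 + r • p.2 - p.1 = r • p.2 := add_sub_cancel_left _ _
  have hnorm : ‖r • p.2‖ = r := norm_smul_of_norm_eq_one hp hr.le
  have hunit : NormedSpace.normalize (r • p.2) = p.2 := by
    rw [NormedSpace.normalize_smul_of_pos hr, NormedSpace.normalize_eq_self_of_norm_eq_one hp]
  obtain ⟨D, hD, hDv⟩ := exists_hasFDerivAt_normalize (x := p.1 + r • p.2 - p.1) (by
    rw [hsub, ← norm_ne_zero_iff, hnorm]; exact hr.ne')
  have hfst_sub_snd : HasFDerivAt (fun q : E d × E d => q.1 - q.2)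
      (ContinuousLinearMap.fst ℝ (E d) (E d) - ContinuousLinearMap.snd ℝ (E d) (E d))
      (p.1 + r • p.2, p.1) :=
    hasFDerivAt_fst.fun_sub hasFDerivAt_snd
  have hder := hasFDerivAt_snd.prodMk
    (HasFDerivAt.comp (g := NormedSpace.normalize) (p.1 + r • p.2, p.1) hD hfst_sub_snd)
  have hmaps : Set.MapsTo (fun q : E d × E d => (q.2, NormedSpace.normalize (q.1 - q.2)))
      ({y | 0 < infDist y A ∧ infDist y A < R}.graphOn (nearest A)) (normalBundleOfReach A) := by
    rintro _ ⟨y, hy, rfl⟩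
    exact hA.mem_normalBundleOfReach_outerNormal hy.1 hy.2
  obtain ⟨t, ht⟩ := hDv (w.1 - w.2)
  have hmem := apply_mem_tangentCone_of_hasFDerivWithinAt hder.hasFDerivWithinAt hmaps hw
  rw [Function.comp_apply, hsub, hunit] at hmem
  rw [hsub, hunit, hnorm] at ht
  exact ⟨D (w.1 - w.2), t, hmem, by rw [add_assoc, ht, add_sub_cancel]⟩

theorem hasFDerivAt_nearest (hA : HasReachAtLeast A R) (hp : p ∈ normalBundleOfReach A)
    (hr : 0 < r) (hrR : r < R) {L : E d →L[ℝ] E d}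
    (hL : ∀ w ∈ tangentCone (normalBundleOfReach A) p, ∀ t : ℝ,
      L (w.1 + r • w.2 + t • p.2) = w.1) :
    HasFDerivAt (nearest A) L (p.1 + r • p.2) := by
  have hdist := hA.infDist_add_smul_of_mem_normalBundle hp hr.le hrR
  obtain ⟨S, hrS, hSR⟩ := exists_between hrR
  have hcont := (Metric.continuous_infDist_pt A).continuousAt (x := p.1 + r • p.2)
  have hU : {y | 0 < infDist y A ∧ infDist y A < R} ∈ 𝓝 (p.1 + r • p.2) :=
    (hcont.eventually_const_lt (hr.trans_eq hdist.symm)).and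
      (hcont.eventually_lt_const (hdist.trans_lt hrR))
  refine hasFDerivAt_of_tangentCone_graphOn (C := R / (R - S)) hU ?_ fun w hw => ?_
  · filter_upwards [hcont.eventually_lt_const (hdist.trans_lt hrS)] with y hy
    exact hA.norm_nearest_sub_nearest_le hSR hy.le (hdist.trans_le hrS.le)
  · rw [hA.nearest_add_smul_of_mem_normalBundle hp hr.le hrR] at hw
    obtain ⟨v, t, hmem, ht⟩ := hA.exists_mem_tangentCone_of_graphOn_nearest hp.2.2 hr hw
    rw [← ht]
    exact hL _ hmem t

theorem exists_hasFDerivAt_nearest (hA : HasReachAtLeast A R)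
    (hreg : IsRegularPair (normalBundleOfReach A) p) (hr : 0 < r) (hrR : r < R) :
    ∃ L : E d →L[ℝ] E d, HasFDerivAt (nearest A) L (p.1 + r • p.2) ∧
      ∀ w ∈ tangentSpace (normalBundleOfReach A) p, L (w.1 + r • w.2) = w.1 := by
  have hp := hreg.1
  set T := tangentSpace (normalBundleOfReach A) p
  let Φ : (T × ℝ) →ₗ[ℝ] E d :=
    ((LinearMap.fst ℝ (E d) (E d) + r • LinearMap.snd ℝ (E d) (E d)) ∘ₗ T.subtype).coprod
      (LinearMap.toSpanSingleton ℝ (E d) p.2)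
  have hΦ (w : T) (t : ℝ) : Φ (w, t) = w.1.1 + r • w.1.2 + t • p.2 := rfl
  have hinj : Function.Injective Φ := by
    rw [← LinearMap.ker_eq_bot, LinearMap.ker_eq_bot']
    rintro ⟨⟨w, hw⟩, t⟩ h0
    replace hw := hreg.mem_tangentCone hw
    rw [hΦ] at h0
    have ht : t = 0 := by
      have h := congrArg (⟪p.2, ·⟫) h0
      simpa [inner_add_right, inner_smul_right, inner_snd_eq_zero_of_mem_tangentCone hp.2.2 hw,
        hA.inner_fst_eq_zero_of_mem_tangentCone hp hw, hp.2.2] using h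
    subst ht
    rw [zero_smul, add_zero] at h0
    exact Prod.ext (Subtype.ext (hA.eq_zero_of_mem_tangentCone hp hr hrR hw h0)) rfl
  let e : (T × ℝ) ≃ₗ[ℝ] E d := LinearEquiv.ofInjectiveOfFinrankEq Φ hinj (by
    rw [Module.finrank_prod, Module.finrank_self, hreg.finrank_tangentSpace,
      finrank_euclideanSpace_fin])
  let L : E d →L[ℝ] E d := LinearMap.toContinuousLinearMap
    (LinearMap.fst ℝ (E d) (E d) ∘ₗ T.subtype ∘ₗ LinearMap.fst ℝ T ℝ ∘ₗ e.symm.toLinearMap)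
  have hL (w : T) (t : ℝ) : L (w.1.1 + r • w.1.2 + t • p.2) = w.1.1 := by
    have he : e.symm (w.1.1 + r • w.1.2 + t • p.2) = (w, t) :=
      e.symm_apply_eq.2 (hΦ w t).symm
    simp [L, he]
  refine ⟨L, hA.hasFDerivAt_nearest hp hr hrR fun w hw t => ?_, fun w hw => ?_⟩
  · rw [← hreg.coe_tangentSpace] at hw
    exact hL ⟨w, hw⟩ t
  · simpa using hL ⟨w, hw⟩ 0

theorem inner_comm_of_mem_tangentSpace (hA : HasReachAtLeast A R)
    (hreg : IsRegularPair (normalBundleOfReach A) p) {w w' : E d × E d}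
    (hw : w ∈ tangentSpace (normalBundleOfReach A) p)
    (hw' : w' ∈ tangentSpace (normalBundleOfReach A) p) :
    ⟪w.1, w'.2⟫ = ⟪w'.1, w.2⟫ := by
  obtain ⟨r, hr, hrR⟩ := exists_between hA.pos
  obtain ⟨L, hder, hL⟩ := hA.exists_hasFDerivAt_nearest hreg hr hrR
  have hsymm := hA.inner_apply_comm_of_hasFDerivAt_nearest
    ((hA.infDist_add_smul_of_mem_normalBundle hreg.1 hr.le hrR).trans_lt hrR) hder
    (w.1 + r • w.2) (w'.1 + r • w'.2)
  rw [hL w hw, hL w' hw', inner_add_right, inner_add_right, real_inner_smul_right,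
    real_inner_smul_right, real_inner_comm] at hsymm
  exact mul_left_cancel₀ hr.ne' (add_left_cancel hsymm)

end HasReachAtLeast

end TangentVectors

/-! ### The index of a bilinear form -/

section Index

variable {V W : Type*} [AddCommGroup V] [Module ℝ V] [FiniteDimensional ℝ V] [AddCommGroup W]
  [Module ℝ W] [FiniteDimensional ℝ W]

theorem index_eq_sigNeg (B : LinearMap.BilinForm ℝ V) :
    index B = sigNeg (LinearMap.BilinMap.toQuadraticMap B) := by
  refine Eq.trans (congrArg sSup (Set.ext fun k => ?_))
    (sigNeg_isGreatest (LinearMap.BilinMap.toQuadraticMap B)).csSup_eq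
  simp [QuadraticMap.PosDef]

theorem exists_finrank_eq_index (B : LinearMap.BilinForm ℝ V) :
    ∃ N : Submodule ℝ V, Module.finrank ℝ N = index B ∧ ∀ w ∈ N, w ≠ 0 → B w w < 0 := by
  rw [index_eq_sigNeg]
  simpa [QuadraticMap.PosDef] using
    exists_finrank_eq_sigNeg_and_negDef (LinearMap.BilinMap.toQuadraticMap B)

theorem finrank_le_index {B : LinearMap.BilinForm ℝ V} {N : Submodule ℝ V}
    (hN : ∀ w ∈ N, w ≠ 0 → B w w < 0) : Module.finrank ℝ N ≤ index B := by
  rw [index_eq_sigNeg]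
  refine le_sigNeg_of_negDef _ ?_
  simpa [QuadraticMap.PosDef] using hN

theorem index_neg_add_index_add_finrank_ker {B : LinearMap.BilinForm ℝ V}
    (hB : ∀ v w, B v w = B w v) :
    index (-B) + index B + Module.finrank ℝ (LinearMap.ker B) = Module.finrank ℝ V := by
  rw [index_eq_sigNeg, index_eq_sigNeg, LinearMap.BilinMap.toQuadraticMap_neg, sigNeg_neg,
    ← QuadraticForm.sigPos_add_sigNeg_add_radical (Q := LinearMap.BilinMap.toQuadraticMap B),
    QuadraticMap.radical_eq_ker_associated, QuadraticMap.associated_left_inverse ℝ hB]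

theorem index_compl₁₂_le (B : LinearMap.BilinForm ℝ W) (f : V →ₗ[ℝ] W) :
    index (B.compl₁₂ f f) ≤ index B := by
  obtain ⟨N, hrank, hN⟩ := exists_finrank_eq_index (B.compl₁₂ f f)
  have hinj : Function.Injective (f.domRestrict N) := by
    rw [← LinearMap.ker_eq_bot, LinearMap.ker_eq_bot']
    intro w hw
    by_contra h0
    have h := hN w w.2 (by simpa using h0)
    rw [LinearMap.compl₁₂_apply, ← LinearMap.domRestrict_apply, hw, map_zero] at h
    exact h.false
  rw [← hrank, ← LinearMap.finrank_range_of_inj hinj]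
  refine finrank_le_index ?_
  rintro _ ⟨w, rfl⟩ hw
  exact hN w w.2 fun h0 => hw (by rw [LinearMap.domRestrict_apply, h0, map_zero])

theorem index_compl₁₂_of_surjective (B : LinearMap.BilinForm ℝ W) {f : V →ₗ[ℝ] W}
    (hf : Function.Surjective f) : index (B.compl₁₂ f f) = index B := by
  obtain ⟨s, hs⟩ := f.exists_rightInverse_of_surjective (LinearMap.range_eq_top.2 hf)
  have hsection : (B.compl₁₂ f f).compl₁₂ s s = B := by
    ext v w
    have hfs := LinearMap.congr_fun hs
    simp only [LinearMap.comp_apply, LinearMap.id_apply] at hfs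
    simp only [LinearMap.compl₁₂_apply, hfs]
  refine (index_compl₁₂_le B f).antisymm ?_
  conv_lhs => rw [← hsection]
  exact index_compl₁₂_le _ s

omit [FiniteDimensional ℝ V] [FiniteDimensional ℝ W] in
theorem nondegenerate_of_compl₁₂ {B : LinearMap.BilinForm ℝ W} {f : V →ₗ[ℝ] W}
    (hf : Function.Surjective f) (h : (B.compl₁₂ f f).Nondegenerate) : B.Nondegenerate := by
  constructor
  · intro w hw
    obtain ⟨v, rfl⟩ := hf w
    rw [h.1 v fun u => hw (f u), map_zero]
  · intro w hw
    obtain ⟨v, rfl⟩ := hf w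
    rw [h.2 v fun u => hw (f u), map_zero]

omit [FiniteDimensional ℝ V] [FiniteDimensional ℝ W] in
theorem ker_compl₁₂_of_nondegenerate {B : LinearMap.BilinForm ℝ W} {f : V →ₗ[ℝ] W}
    (hf : Function.Surjective f) (h : B.Nondegenerate) :
    LinearMap.ker (B.compl₁₂ f f) = LinearMap.ker f := by
  ext v
  simp only [LinearMap.mem_ker, LinearMap.ext_iff, LinearMap.compl₁₂_apply, LinearMap.zero_apply]
  refine ⟨fun hv => h.1 (f v) fun w => ?_, fun hv w => by rw [hv, map_zero, LinearMap.zero_apply]⟩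
  obtain ⟨u, rfl⟩ := hf w
  exact hv u

end Index

/-! ### The family of Hessian forms of the offsets -/

section OffsetForm

theorem eventually_forall_neg_of_homogeneous {X V : Type*} [TopologicalSpace X]
    [NormedAddCommGroup V] [NormedSpace ℝ V] [ProperSpace V] {Q : X → V → ℝ} {x : X}
    (hQ : Continuous (Function.uncurry Q)) (hsmul : ∀ y (c : ℝ) v, Q y (c • v) = c ^ 2 * Q y v)
    (hneg : ∀ v, v ≠ 0 → Q x v < 0) : ∀ᶠ y in 𝓝 x, ∀ v, v ≠ 0 → Q y v < 0 := by
  have hsphere : ∀ᶠ y in 𝓝 x, ∀ v ∈ Metric.sphere (0 : V) 1, Q y v < 0 :=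
    (isCompact_sphere (0 : V) 1).eventually_forall_of_forall_eventually fun v hv =>
      hQ.continuousAt.eventually (gt_mem_nhds (hneg v (ne_zero_of_mem_unit_sphere ⟨v, hv⟩)))
  filter_upwards [hsphere] with y hy v hv
  have h := hy (NormedSpace.normalize v) (by
    rw [mem_sphere_zero_iff_norm, NormedSpace.norm_normalize hv])
  rw [← NormedSpace.norm_smul_normalize v, hsmul]
  exact mul_neg_of_pos_of_neg (by positivity) h

variable {V F : Type*} [NormedAddCommGroup V] [NormedSpace ℝ V]
  [NormedAddCommGroup F] [InnerProductSpace ℝ F] (H : F →L[ℝ] F →L[ℝ] ℝ) (g : ℝ) (α β : V →ₗ[ℝ] F)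

/-- The Hessian of the translate of a function restricted to the `r`-offset of a set, pulled back to
the tangent space `V` of the unit normal bundle of the set: `α` and `β` are the components of the
inclusion of `V` into pairs of vectors, `H` is the Hessian of the function and `g` the norm of its
gradient. -/
def offsetForm (r : ℝ) : LinearMap.BilinForm ℝ V :=
  H.toLinearMap₁₂.compl₁₂ (α + r • β) (α + r • β) - g • (innerₗ F).compl₁₂ (α + r • β) β

theorem offsetForm_apply (r : ℝ) (p q : V) : offsetForm H g α β r p q =
    H (α p + r • β p) (α q + r • β q) - g * ⟪α p + r • β p, β q⟫ := rfl

theorem offsetForm_neg (r : ℝ) : offsetForm (-H) (-g) α β r = -offsetForm H g α β r := by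
  ext p q
  simp only [offsetForm_apply, LinearMap.neg_apply, neg_apply]
  ring

variable {H g α β}

theorem offsetForm_comm (hH : ∀ u v, H u v = H v u) (hαβ : ∀ p q, ⟪α p, β q⟫ = ⟪α q, β p⟫) (r : ℝ)
    (p q : V) : offsetForm H g α β r p q = offsetForm H g α β r q p := by
  simp only [offsetForm_apply, inner_add_left, real_inner_smul_left]
  rw [hH, hαβ, real_inner_comm (β p) (β q)]

variable [FiniteDimensional ℝ V]

theorem eventually_offsetForm_neg {N : Submodule ℝ V}
    (hN : ∀ p ∈ N, p ≠ 0 → offsetForm H g α β 0 p p < 0) :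
    ∀ᶠ r in 𝓝 0, ∀ p ∈ N, p ≠ 0 → offsetForm H g α β r p p < 0 := by
  have hα := α.continuous_of_finiteDimensional
  have hβ := β.continuous_of_finiteDimensional
  have h := eventually_forall_neg_of_homogeneous (V := N) (x := (0 : ℝ))
    (Q := fun r p => offsetForm H g α β r p p) ?_ ?_ fun p hp => hN p p.2 (by simpa using hp)
  · exact h.mono fun r hr p hp hp0 => hr ⟨p, hp⟩ (by simpa using hp0)
  · simp only [offsetForm_apply, Function.uncurry_def]
    fun_prop
  · intro r c p
    simp only [Submodule.coe_smul, map_smul, LinearMap.smul_apply, smul_eq_mul]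
    ring

variable (H g α β) in
/-- The value of `offsetForm` for the parameter `t ^ 2` at `p + t⁻¹ • k` where `α k = 0`, written so
that it makes sense and is continuous at `t = 0` too. -/
def rescaledOffsetForm (t : ℝ) (p k : V) : ℝ :=
  H (α p + t ^ 2 • β p + t • β k) (α p + t ^ 2 • β p + t • β k) -
    g * (⟪α p, β p⟫ + ‖t • β p + β k‖ ^ 2)

omit [FiniteDimensional ℝ V] in
theorem offsetForm_add_of_mem_ker (hαβ : ∀ p q, ⟪α p, β q⟫ = ⟪α q, β p⟫) {r : ℝ} (hr : 0 ≤ r)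
    (p : V) {k : V} (hk : k ∈ LinearMap.ker α) :
    offsetForm H g α β r (p + k) (p + k) = rescaledOffsetForm H g α β √r p (√r • k) := by
  rw [LinearMap.mem_ker] at hk
  have hpk : ⟪α p, β k⟫ = 0 := by rw [hαβ, hk, inner_zero_left]
  have hfst : α (p + k) + r • β (p + k) = α p + √r ^ 2 • β p + √r • β (√r • k) := by
    rw [map_add, hk, add_zero, map_add, map_smul, smul_smul, Real.mul_self_sqrt hr,
      Real.sq_sqrt hr, smul_add, add_assoc]
  have hsnd : ⟪α (p + k) + r • β (p + k), β (p + k)⟫ =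
      ⟪α p, β p⟫ + ‖√r • β p + β (√r • k)‖ ^ 2 := by
    rw [map_add, hk, add_zero, inner_add_left, map_add, inner_add_right, hpk, add_zero,
      map_smul, ← smul_add, norm_smul, mul_pow, Real.norm_eq_abs, sq_abs, Real.sq_sqrt hr,
      real_inner_smul_left, real_inner_self_eq_norm_sq]
  rw [offsetForm_apply, hsnd, hfst, rescaledOffsetForm]

omit [FiniteDimensional ℝ V] in
theorem rescaledOffsetForm_zero_left (p k : V) :
    rescaledOffsetForm H g α β 0 p k = offsetForm H g α β 0 p p - g * ‖β k‖ ^ 2 := by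
  simp only [rescaledOffsetForm, offsetForm_apply, ne_eq, OfNat.ofNat_ne_zero, not_false_eq_true,
    zero_pow, zero_smul, add_zero, zero_add]
  ring

omit [FiniteDimensional ℝ V] in
theorem rescaledOffsetForm_smul (t c : ℝ) (p k : V) :
    rescaledOffsetForm H g α β t (c • p) (c • k) = c ^ 2 * rescaledOffsetForm H g α β t p k := by
  simp only [rescaledOffsetForm, map_smul, smul_comm _ c, ← smul_add, smul_apply, smul_eq_mul,
    norm_smul, real_inner_smul_left, real_inner_smul_right, mul_pow, Real.norm_eq_abs, sq_abs]
  ring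

theorem eventually_rescaledOffsetForm_neg (hg : 0 < g) (hker : ∀ p, α p = 0 → β p = 0 → p = 0)
    {N : Submodule ℝ V} (hN : ∀ p ∈ N, p ≠ 0 → offsetForm H g α β 0 p p < 0) :
    ∀ᶠ t in 𝓝 0, ∀ p ∈ N, ∀ k ∈ LinearMap.ker α, (p = 0 → k ≠ 0) →
      rescaledOffsetForm H g α β t p k < 0 := by
  have hα := α.continuous_of_finiteDimensional
  have hβ := β.continuous_of_finiteDimensional
  have h := eventually_forall_neg_of_homogeneous (x := (0 : ℝ)) (V := N × LinearMap.ker α)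
    (Q := fun t x => rescaledOffsetForm H g α β t x.1 x.2)
    (by unfold rescaledOffsetForm; fun_prop) (fun t c _ => rescaledOffsetForm_smul t c _ _) ?_
  · filter_upwards [h] with t ht p hp k hk hpk
    refine ht (⟨p, hp⟩, ⟨k, hk⟩) fun h0 => ?_
    simp only [Prod.mk_eq_zero, Submodule.mk_eq_zero] at h0
    exact hpk h0.1 h0.2
  rintro ⟨p, k⟩ hx
  rw [rescaledOffsetForm_zero_left]
  by_cases hp : p = 0
  · have hk : β k ≠ 0 := fun h => hx (Prod.ext hp (Subtype.ext (hker _ k.2 h)))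
    rw [hp, Submodule.coe_zero, map_zero, zero_sub, neg_lt_zero]
    positivity
  · have hk : 0 ≤ g * ‖β k‖ ^ 2 := by positivity
    linarith [hN p p.2 (by simpa using hp)]

theorem eventually_offsetForm_add_neg (hg : 0 < g) (hαβ : ∀ p q, ⟪α p, β q⟫ = ⟪α q, β p⟫)
    (hker : ∀ p, α p = 0 → β p = 0 → p = 0) {N : Submodule ℝ V}
    (hN : ∀ p ∈ N, p ≠ 0 → offsetForm H g α β 0 p p < 0) :
    ∀ᶠ r in 𝓝[>] 0, ∀ p ∈ N, ∀ k ∈ LinearMap.ker α, p + k ≠ 0 →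
      offsetForm H g α β r (p + k) (p + k) < 0 := by
  have hsqrt : Tendsto Real.sqrt (𝓝[>] 0) (𝓝 0) := by
    simpa using (Real.continuous_sqrt.tendsto 0).mono_left nhdsWithin_le_nhds
  filter_upwards [hsqrt.eventually (eventually_rescaledOffsetForm_neg hg hker hN),
    self_mem_nhdsWithin] with r hr (hr0 : 0 < r) p hp k hk hpk
  rw [offsetForm_add_of_mem_ker hαβ hr0.le p hk]
  refine hr p hp _ (Submodule.smul_mem _ _ hk) fun h0 => ?_
  rw [h0, zero_add] at hpk
  exact smul_ne_zero (Real.sqrt_ne_zero'.2 hr0) hpk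

theorem eventually_nondegenerate_index_offsetForm (hg : 0 < g) (hH : ∀ u v, H u v = H v u)
    (hαβ : ∀ p q, ⟪α p, β q⟫ = ⟪α q, β p⟫) (hker : ∀ p, α p = 0 → β p = 0 → p = 0)
    (hker₀ : LinearMap.ker (offsetForm H g α β 0) = LinearMap.ker α) :
    ∀ᶠ r in 𝓝[>] 0, (offsetForm H g α β r).Nondegenerate ∧
      index (offsetForm H g α β r) =
        index (offsetForm H g α β 0) + Module.finrank ℝ (LinearMap.ker α) := by
  obtain ⟨N, hNrank, hN⟩ := exists_finrank_eq_index (offsetForm H g α β 0)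
  obtain ⟨P, hPrank, hP⟩ := exists_finrank_eq_index (-offsetForm H g α β 0)
  have hdisj : N ⊓ LinearMap.ker α = ⊥ := by
    rw [eq_bot_iff]
    rintro p ⟨hpN, hpα⟩
    by_contra hp
    have hp0 : offsetForm H g α β 0 p = 0 := by rwa [← hker₀] at hpα
    exact (hN p hpN hp).ne (by rw [hp0, LinearMap.zero_apply])
  have hsup : Module.finrank ℝ (N ⊔ LinearMap.ker α : Submodule ℝ V) =
      index (offsetForm H g α β 0) + Module.finrank ℝ (LinearMap.ker α) := by
    rw [← hNrank, ← Submodule.finrank_sup_add_finrank_inf_eq, hdisj, finrank_bot, add_zero]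
  rw [← offsetForm_neg] at hP hPrank
  filter_upwards [eventually_offsetForm_add_neg hg hαβ hker hN,
    nhdsWithin_le_nhds (eventually_offsetForm_neg hP)] with r hr hr'
  have hneg : index (offsetForm H g α β 0) + Module.finrank ℝ (LinearMap.ker α) ≤
      index (offsetForm H g α β r) := by
    rw [← hsup]
    refine finrank_le_index fun w hw hw0 => ?_
    obtain ⟨p, hp, k, hk, rfl⟩ := Submodule.mem_sup.1 hw
    exact hr p hp k hk hw0
  have hpos : index (-offsetForm H g α β 0) ≤ index (-offsetForm H g α β r) := by
    rw [← offsetForm_neg, ← hPrank, ← offsetForm_neg]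
    exact finrank_le_index hr'
  have hcomm := offsetForm_comm (α := α) (β := β) (g := g) hH hαβ
  have h0 := index_neg_add_index_add_finrank_ker (hcomm 0)
  have h1 := index_neg_add_index_add_finrank_ker (hcomm r)
  rw [hker₀] at h0
  have hbot : LinearMap.ker (offsetForm H g α β r) = ⊥ := Submodule.finrank_eq_zero.1 (by lia)
  have hsep := LinearMap.separatingLeft_iff_ker_eq_bot.2 hbot
  exact ⟨⟨hsep, fun q hq => hsep q fun p => (hcomm r q p).trans (hq p)⟩, by lia⟩

end OffsetForm

/-! ### Principal curvatures -/

section PrincipalCurvatures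

variable {F : Type*} [NormedAddCommGroup F] [InnerProductSpace ℝ F] [FiniteDimensional ℝ F]

theorem exists_isSymmetric_forall_mem_of_isotropic {W : Submodule ℝ F} {T : Submodule ℝ (F × F)}
    (hdim : Module.finrank ℝ T = Module.finrank ℝ W) (hTW : ∀ w ∈ T, w.1 ∈ W ∧ w.2 ∈ W)
    (hiso : ∀ w ∈ T, ∀ w' ∈ T, ⟪w.1, w'.2⟫ = ⟪w'.1, w.2⟫) {r : ℝ} (hr : r ≠ 0)
    (hinj : ∀ w ∈ T, w.1 + r • w.2 = 0 → w = 0) :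
    ∃ S : W →ₗ[ℝ] W, S.IsSymmetric ∧ ∀ u : W, ((S u : F), r⁻¹ • (u - S u : F)) ∈ T := by
  let e₀ : T →ₗ[ℝ] W :=
    ((LinearMap.fst ℝ F F + r • LinearMap.snd ℝ F F) ∘ₗ T.subtype).codRestrict W fun w =>
      W.add_mem (hTW w w.2).1 (W.smul_mem r (hTW w w.2).2)
  have he₀ : Function.Injective e₀ := (injective_iff_map_eq_zero e₀).2 fun w hw =>
    Subtype.ext (hinj w w.2 (congrArg Subtype.val hw))
  let e : T ≃ₗ[ℝ] W := LinearEquiv.ofInjectiveOfFinrankEq e₀ he₀ hdim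
  have he (w : T) : (e w : F) = (w : F × F).1 + r • (w : F × F).2 := rfl
  let S : W →ₗ[ℝ] W := (LinearMap.fst ℝ F F ∘ₗ T.subtype).codRestrict W
    (fun w => (hTW w w.2).1) ∘ₗ e.symm.toLinearMap
  have hSe (w : T) : (S (e w) : F) = (w : F × F).1 :=
    congrArg (fun w' : T => (w' : F × F).1) (e.symm_apply_apply w)
  refine ⟨S, fun a a' => ?_, fun u => ?_⟩
  · obtain ⟨w, rfl⟩ := e.surjective a
    obtain ⟨w', rfl⟩ := e.surjective a'
    rw [Submodule.coe_inner, Submodule.coe_inner, hSe, hSe, he, he, inner_add_left,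
      inner_add_right, real_inner_smul_left, real_inner_smul_right, hiso w w.2 w' w'.2,
      real_inner_comm (w' : F × F).1 (w : F × F).2]
  · obtain ⟨w, rfl⟩ := e.surjective u
    rw [hSe, he, add_sub_cancel_left, inv_smul_smul₀ hr]
    exact w.2

theorem exists_orthonormal_smul_mem_of_isotropic {m : ℕ} {W : Submodule ℝ F}
    {T : Submodule ℝ (F × F)} (hW : Module.finrank ℝ W = m) (hTm : Module.finrank ℝ T = m)
    (hTW : ∀ w ∈ T, w.1 ∈ W ∧ w.2 ∈ W) (hiso : ∀ w ∈ T, ∀ w' ∈ T, ⟪w.1, w'.2⟫ = ⟪w'.1, w.2⟫)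
    {r : ℝ} (hr : r ≠ 0) (hinj : ∀ w ∈ T, w.1 + r • w.2 = 0 → w = 0) :
    ∃ b : Fin m → F, Orthonormal ℝ b ∧
      ∀ i, b i ∈ W ∧ ∃ c s : ℝ, (c, s) ≠ 0 ∧ (c • b i, s • b i) ∈ T := by
  obtain ⟨S, hS, hST⟩ :=
    exists_isSymmetric_forall_mem_of_isotropic (hTm.trans hW.symm) hTW hiso hr hinj
  refine ⟨fun i => hS.eigenvectorBasis hW i,
    (hS.eigenvectorBasis hW).orthonormal.comp_linearIsometry W.subtypeₗᵢ, fun i =>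
      ⟨Subtype.property _, hS.eigenvalues hW i, r⁻¹ * (1 - hS.eigenvalues hW i), ?_, ?_⟩⟩
  · simp only [ne_eq, Prod.mk_eq_zero, mul_eq_zero, inv_eq_zero, hr, false_or]
    rintro ⟨h0, h1⟩
    rw [h0] at h1
    norm_num at h1
  · have h := hST (hS.eigenvectorBasis hW i)
    rw [hS.apply_eigenvectorBasis hW i] at h
    rw [mul_smul, sub_smul, one_smul]
    exact h

theorem principalVector_top (b : E d) : principalVector ⊤ b = (0, b) := rfl

theorem exists_principalVector_eq (κ : WithTop ℝ) : ∃ c s : ℝ, c ^ 2 + s ^ 2 = 1 ∧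
    (c = 0 → κ = ⊤) ∧ ∀ b : E d, principalVector κ b = (c • b, s • b) := by
  induction κ using WithTop.recTopCoe with
  | top => exact ⟨0, 1, by norm_num, fun _ => rfl, fun b => by simp [principalVector_top]⟩
  | coe k =>
    have hk : 0 < 1 + k ^ 2 := by positivity
    refine ⟨1 / √(1 + k ^ 2), k / √(1 + k ^ 2), ?_, fun h0 => ?_, fun b => rfl⟩
    · rw [div_pow, div_pow, Real.sq_sqrt hk.le, ← add_div, one_pow, div_self hk.ne']
    · exact absurd h0 (one_div_pos.2 (Real.sqrt_pos.2 hk)).ne'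

theorem exists_principalVector_mem {T : Submodule ℝ (E d × E d)} {b : E d} {c s : ℝ}
    (hcs : (c, s) ≠ 0) (hT : (c • b, s • b) ∈ T) : ∃ κ, principalVector κ b ∈ T := by
  by_cases hc : c = 0
  · have hs : s ≠ 0 := fun hs => hcs (by rw [hc, hs]; rfl)
    refine ⟨⊤, ?_⟩
    rw [principalVector_top]
    simpa [hc, inv_smul_smul₀ hs] using T.smul_mem s⁻¹ hT
  · refine ⟨(s / c : ℝ), ?_⟩
    have h := T.smul_mem (1 / √(1 + (s / c) ^ 2) / c) hT
    rw [Prod.smul_mk, smul_smul, smul_smul, div_mul_cancel₀ _ hc, div_mul_eq_mul_div,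
      div_mul_eq_mul_div, one_mul, div_right_comm] at h
    exact h

theorem inner_toLp_prod (v w : E d × E d) :
    ⟪WithLp.toLp 2 v, WithLp.toLp 2 w⟫ = ⟪v.1, w.1⟫ + ⟪v.2, w.2⟫ := rfl

theorem orthonormal_principalVector {ι : Type*} {b : ι → E d} (hb : Orthonormal ℝ b)
    (κ : ι → WithTop ℝ) : Orthonormal ℝ fun i => WithLp.toLp 2 (principalVector (κ i) (b i)) := by
  choose c s hcs _ hκ using fun i => exists_principalVector_eq (d := d) (κ i)
  constructor
  · intro i
    rw [← sq_eq_sq₀ (norm_nonneg _) zero_le_one, ← real_inner_self_eq_norm_sq, inner_toLp_prod, hκ]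
    simp only [real_inner_self_eq_norm_sq, norm_smul, hb.1 i, mul_one, one_pow, Real.norm_eq_abs,
      sq_abs, hcs i]
  · intro i j hij
    rw [inner_toLp_prod, hκ, hκ]
    simp only [real_inner_smul_left, real_inner_smul_right, hb.2 hij, mul_zero, add_zero]

theorem linearIndependent_of_orthonormal_toLp {ι : Type*} {v : ι → E d × E d}
    (hv : Orthonormal ℝ fun i => WithLp.toLp 2 (v i)) : LinearIndependent ℝ v :=
  hv.linearIndependent.map' (WithLp.linearEquiv 2 ℝ (E d × E d)).toLinearMap
    (LinearEquiv.ker _)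

theorem HasReachAtLeast.exists_isPrincipalCurvatures {A : Set (E d)} {R : ℝ}
    (hA : HasReachAtLeast A R) {x n : E d} (hreg : IsRegularPair (normalBundleOfReach A) (x, n)) :
    ∃ κ b, IsPrincipalCurvatures (normalBundleOfReach A) x n κ b := by
  have hp := hreg.1
  have hdim := hreg.finrank_tangentSpace
  have hn : n ≠ 0 := ne_zero_of_norm_ne_zero (ne_of_eq_of_ne hp.2.2 one_ne_zero)
  have : Fact (Module.finrank ℝ (E d) = d - 1 + 1) := ⟨by rw [finrank_euclideanSpace_fin]; lia⟩
  obtain ⟨b, hb, hbT⟩ := exists_orthonormal_smul_mem_of_isotropic (W := (ℝ ∙ n)ᗮ)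
    (Submodule.finrank_orthogonal_span_singleton hn) (Nat.eq_sub_of_add_eq hdim)
    (fun w hw => ⟨Submodule.mem_orthogonal_singleton_iff_inner_right.2
      (hA.inner_fst_eq_zero_of_mem_tangentCone hp (hreg.mem_tangentCone hw)),
      Submodule.mem_orthogonal_singleton_iff_inner_right.2
      (inner_snd_eq_zero_of_mem_tangentCone hp.2.2 (hreg.mem_tangentCone hw))⟩)
    (fun w hw w' hw' => hA.inner_comm_of_mem_tangentSpace hreg hw hw')
    (half_pos hA.pos).ne' fun w hw =>
      hA.eq_zero_of_mem_tangentCone hp (half_pos hA.pos) (half_lt_self hA.pos)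
        (hreg.mem_tangentCone hw)
  choose hbn c s hcs hmem using hbT
  choose κ hκ using fun i => exists_principalVector_mem (hcs i) (hmem i)
  have hon := orthonormal_principalVector hb κ
  refine ⟨κ, b, fun i => Submodule.mem_orthogonal_singleton_iff_inner_left.1 (hbn i), hon, ?_⟩
  rw [← hreg.coe_tangentSpace,
    Submodule.eq_of_le_of_finrank_eq (Submodule.span_le.2 (Set.range_subset_iff.2 hκ))]
  rw [finrank_span_eq_card (linearIndependent_of_orthonormal_toLp hon), Fintype.card_fin]
  exact (Nat.eq_sub_of_add_eq hdim).symm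

section

variable {m : ℕ} {κ : Fin m → WithTop ℝ} {b : Fin m → E d} {T : Submodule ℝ (E d × E d)}
  (hiso : ∀ w ∈ T, ∀ w' ∈ T, ⟪w.1, w'.2⟫ = ⟪w'.1, w.2⟫)
  (hon : Orthonormal ℝ fun i => WithLp.toLp 2 (principalVector (κ i) (b i)))
  (hspan : Submodule.span ℝ (Set.range fun i => principalVector (κ i) (b i)) = T)
include hiso hon hspan

theorem map_ker_fst_eq_span_principalVector :
    (LinearMap.ker (LinearMap.fst ℝ (E d) (E d) ∘ₗ T.subtype)).map T.subtype =
      Submodule.span ℝ (Set.range fun i : {i // κ i = ⊤} => principalVector (κ i) (b i)) := by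
  have hmem (i : Fin m) : principalVector (κ i) (b i) ∈ T :=
    hspan ▸ Submodule.subset_span ⟨i, rfl⟩
  refine le_antisymm ?_ (Submodule.span_le.2 ?_)
  · rintro _ ⟨⟨w, hw⟩, hw0 : w.1 = 0, rfl⟩
    have horth (i : Fin m) (hi : κ i ≠ ⊤) :
        ⟪WithLp.toLp 2 (principalVector (κ i) (b i)), WithLp.toLp 2 w⟫ = 0 := by
      obtain ⟨c, s, -, hc, hcs⟩ := exists_principalVector_eq (d := d) (κ i)
      have h := hiso _ (hmem i) w hw
      rw [hw0, inner_zero_left, hcs, real_inner_smul_left] at h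
      have hb : ⟪b i, w.2⟫ = 0 := (mul_eq_zero.1 h).resolve_left (mt hc hi)
      rw [inner_toLp_prod, hw0, inner_zero_right, zero_add, hcs, real_inner_smul_left, hb, mul_zero]
    have hw' := hw
    rw [← hspan, Submodule.mem_span_range_iff_exists_fun] at hw'
    obtain ⟨a, rfl⟩ := hw'
    have ha (i : Fin m) (hi : κ i ≠ ⊤) : a i = 0 := by
      rw [← horth i hi, WithLp.toLp_sum, ← hon.inner_right_fintype a i]
      rfl
    refine Submodule.sum_mem (t := Finset.univ) (f := fun i => a i • principalVector (κ i) (b i)) _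
      fun i _ => ?_
    by_cases hi : κ i = ⊤
    · exact Submodule.smul_mem _ _ (Submodule.subset_span ⟨⟨i, hi⟩, rfl⟩)
    · rw [ha i hi, zero_smul]
      exact Submodule.zero_mem _
  · rintro _ ⟨⟨i, hi⟩, rfl⟩
    refine ⟨⟨_, hmem i⟩, ?_, rfl⟩
    simp [hi, principalVector_top]

theorem finrank_ker_fst_eq_numInfinite :
    Module.finrank ℝ (LinearMap.ker (LinearMap.fst ℝ (E d) (E d) ∘ₗ T.subtype)) =
      numInfinite κ := by
  classical
  have hli : LinearIndependent ℝ fun i : {i // κ i = ⊤} => principalVector (κ i) (b i) :=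
    (linearIndependent_of_orthonormal_toLp hon).comp _ Subtype.val_injective
  rw [← Submodule.finrank_map_subtype_eq T, map_ker_fst_eq_span_principalVector hiso hon hspan,
    finrank_span_eq_card hli, numInfinite, ← Nat.card_coe_set_eq, Nat.card_eq_fintype_card]
  rfl

end

theorem IsPrincipalCurvatures.finrank_ker_fst {A : Set (E d)} {R : ℝ} (hA : HasReachAtLeast A R)
    {x n : E d} (hreg : IsRegularPair (normalBundleOfReach A) (x, n)) {κ : Fin (d - 1) → WithTop ℝ}
    {b : Fin (d - 1) → E d} (hκ : IsPrincipalCurvatures (normalBundleOfReach A) x n κ b) :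
    Module.finrank ℝ (LinearMap.ker (LinearMap.fst ℝ (E d) (E d) ∘ₗ
      (tangentSpace (normalBundleOfReach A) (x, n)).subtype)) = numInfinite κ :=
  finrank_ker_fst_eq_numInfinite
    (fun _ hw _ hw' => hA.inner_comm_of_mem_tangentSpace hreg hw hw') hκ.orthonormal
    (SetLike.coe_injective (hκ.span_eq.trans hreg.coe_tangentSpace.symm))

end PrincipalCurvatures

/-! ### Hessians of erosions -/

section OffsetTangentSpace

variable {d : ℕ} {N : Set (E d × E d)} {p : E d × E d} {r : ℝ}

theorem finrank_comap_offsetMap (T : Submodule ℝ (E d × E d)) (r : ℝ) :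
    Module.finrank ℝ (T.comap (offsetMap r).toLinearMap) = Module.finrank ℝ T := by
  let e : (E d × E d) ≃ₗ[ℝ] E d × E d :=
    LinearEquiv.ofInvolutive (offsetMap r).toLinearMap (offsetMap_offsetMap r)
  change Module.finrank ℝ (T.comap e.toLinearMap) = _
  rw [Submodule.comap_equiv_eq_map_symm, LinearEquiv.finrank_map_eq]

theorem tangentSpace_preimage_offsetMap (r : ℝ) (N : Set (E d × E d)) (p : E d × E d) :
    tangentSpace (offsetMap r ⁻¹' N) p =
      (tangentSpace N (offsetMap r p)).comap (offsetMap r).toLinearMap := by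
  let e : (E d × E d) ≃ₗ[ℝ] E d × E d :=
    LinearEquiv.ofInvolutive (offsetMap r).toLinearMap (offsetMap_offsetMap r)
  change Submodule.span ℝ _ = (Submodule.span ℝ _).comap e.toLinearMap
  rw [tangentCone_preimage_offsetMap, Submodule.comap_equiv_eq_map_symm, Submodule.map_span]
  congr 1
  exact (Equiv.image_symm_eq_preimage e.toEquiv _).symm

theorem IsRegularPair.preimage_offsetMap (h : IsRegularPair N (offsetMap r p)) :
    IsRegularPair (offsetMap r ⁻¹' N) p := by
  refine ⟨h.1, (tangentSpace N (offsetMap r p)).comap (offsetMap r).toLinearMap, ?_, ?_⟩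
  · rw [tangentCone_preimage_offsetMap, ← h.coe_tangentSpace]
    rfl
  · rw [finrank_comap_offsetMap, h.finrank_tangentSpace]

theorem isRegularPair_preimage_offsetMap :
    IsRegularPair (offsetMap r ⁻¹' N) p ↔ IsRegularPair N (offsetMap r p) := by
  refine ⟨fun h => ?_, IsRegularPair.preimage_offsetMap⟩
  rw [← offsetMap_offsetMap r p] at h
  have h' := h.preimage_offsetMap
  rwa [← Set.preimage_comp, Function.Involutive.comp_self (offsetMap_offsetMap r),
    Set.preimage_id] at h'

end OffsetTangentSpace

section RestrictedHessian

variable {d : ℕ} {f : E d → ℝ} {X : Set (E d)} {x : E d} {T S : Submodule ℝ (E d × E d)} {r : ℝ}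

theorem restrictedHessian_toFirstProj
    (h : ∀ p ∈ criticalTangentSpace f X x, ∀ w : E d,
      ((0 : E d), w) ∈ criticalTangentSpace f X x → ⟪p.1, w⟫ = 0)
    (p q : criticalTangentSpace f X x) :
    restrictedHessian f X x (toFirstProj _ p) (toFirstProj _ q) =
      fderiv ℝ (fderiv ℝ f) x (p : E d × E d).1 (q : E d × E d).1 +
        ‖gradient f x‖ * ⟪(p : E d × E d).1, (q : E d × E d).2⟫ := by
  rw [← secondFundamentalForm_apply _ h]
  rfl

/-- For a space `S` of pairs that is the preimage of `T` under the involution `offsetMap r`, the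
map `(u, v) ↦ u + r v` from `T` onto `π₀(S)`. It allows the Hessians on the varying spaces `π₀(S)`
to be compared on the fixed space `T`. -/
def offsetProj (hS : S = T.comap (offsetMap r).toLinearMap) : T →ₗ[ℝ] firstProj S :=
  toFirstProj S ∘ₗ ((offsetMap r).toLinearMap ∘ₗ T.subtype).codRestrict S fun p => by
    rw [hS, Submodule.mem_comap]
    exact (offsetMap_offsetMap r (p : E d × E d)).symm ▸ p.2

theorem offsetProj_apply (hS : S = T.comap (offsetMap r).toLinearMap) (p : T) :
    (offsetProj hS p : E d) = (p : E d × E d).1 + r • (p : E d × E d).2 := rfl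

theorem offsetProj_surjective (hS : S = T.comap (offsetMap r).toLinearMap) :
    Function.Surjective (offsetProj hS) := by
  rintro ⟨_, w, hw, rfl⟩
  have hw' : offsetMap r w ∈ T := hS.le hw
  refine ⟨⟨offsetMap r w, hw'⟩, Subtype.ext ?_⟩
  simp [offsetProj_apply]

theorem ker_offsetProj_zero (hS : S = T.comap (offsetMap 0).toLinearMap) :
    LinearMap.ker (offsetProj hS) = LinearMap.ker (LinearMap.fst ℝ (E d) (E d) ∘ₗ T.subtype) := by
  ext p
  simp [LinearMap.mem_ker, ← Submodule.coe_eq_zero, offsetProj_apply]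

theorem restrictedHessian_compl₁₂_offsetProj
    (hiso : ∀ w ∈ T, ∀ w' ∈ T, ⟪w.1, w'.2⟫ = ⟪w'.1, w.2⟫)
    (hS : criticalTangentSpace f X x = T.comap (offsetMap r).toLinearMap) :
    (restrictedHessian f X x).compl₁₂ (offsetProj hS) (offsetProj hS) =
      offsetForm (fderiv ℝ (fderiv ℝ f) x) ‖gradient f x‖
        (LinearMap.fst ℝ (E d) (E d) ∘ₗ T.subtype)
        (LinearMap.snd ℝ (E d) (E d) ∘ₗ T.subtype) r := by
  have horth : ∀ p ∈ criticalTangentSpace f X x, ∀ w : E d,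
      ((0 : E d), w) ∈ criticalTangentSpace f X x → ⟪p.1, w⟫ = 0 := by
    intro p hp w hw
    rw [hS, Submodule.mem_comap] at hp hw
    have h := hiso _ hp _ hw
    simp only [ContinuousLinearMap.coe_coe, offsetMap_apply, zero_add, inner_add_left,
      inner_neg_right, real_inner_smul_left] at h
    rw [real_inner_comm w p.2] at h
    linarith
  ext p q
  refine (restrictedHessian_toFirstProj horth _ _).trans ?_
  rw [offsetForm_apply, sub_eq_add_neg, ← mul_neg, ← inner_neg_right]
  rfl

theorem eventually_nondegenerate_index_restrictedHessian
    (hiso : ∀ w ∈ T, ∀ w' ∈ T, ⟪w.1, w'.2⟫ = ⟪w'.1, w.2⟫) (hf : ContDiffAt ℝ 2 f x)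
    (hg : gradient f x ≠ 0) (hS₀ : criticalTangentSpace f X x = T.comap (offsetMap 0).toLinearMap)
    (hnd : (restrictedHessian f X x).Nondegenerate) :
    ∀ᶠ r in 𝓝[>] 0, ∀ (f' : E d → ℝ) (X' : Set (E d)) (x' : E d),
      fderiv ℝ (fderiv ℝ f') x' = fderiv ℝ (fderiv ℝ f) x → gradient f' x' = gradient f x →
      criticalTangentSpace f' X' x' = T.comap (offsetMap r).toLinearMap →
      (restrictedHessian f' X' x').Nondegenerate ∧
        index (restrictedHessian f' X' x') = index (restrictedHessian f X x) +
          Module.finrank ℝ (LinearMap.ker (LinearMap.fst ℝ (E d) (E d) ∘ₗ T.subtype)) := by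
  have hform₀ := restrictedHessian_compl₁₂_offsetProj hiso hS₀
  have hsymm : IsSymmSndFDerivAt ℝ f x := hf.isSymmSndFDerivAt (by simp)
  filter_upwards [eventually_nondegenerate_index_offsetForm
    (α := LinearMap.fst ℝ (E d) (E d) ∘ₗ T.subtype) (β := LinearMap.snd ℝ (E d) (E d) ∘ₗ T.subtype)
    (norm_pos_iff.2 hg) hsymm.eq (fun p q => hiso p p.2 q q.2)
    (fun p h₁ h₂ => Subtype.ext (Prod.ext h₁ h₂))
    (by rw [← hform₀, ker_compl₁₂_of_nondegenerate (offsetProj_surjective hS₀) hnd,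
      ker_offsetProj_zero])] with r hr f' X' x' hH hgrad hS
  rw [← hform₀, ← hH, ← hgrad, ← restrictedHessian_compl₁₂_offsetProj hiso hS,
    index_compl₁₂_of_surjective _ (offsetProj_surjective hS),
    index_compl₁₂_of_surjective _ (offsetProj_surjective hS₀)] at hr
  exact hr.imp_left (nondegenerate_of_compl₁₂ (offsetProj_surjective hS))

end RestrictedHessian

section TranslatedFun

variable {d : ℕ} (f : E d → ℝ) (x : E d) (r : ℝ)

theorem fderiv_translatedFun (y : E d) :
    fderiv ℝ (translatedFun f x r) y = fderiv ℝ f (y - r • unitGradient f x) :=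
  fderiv_comp_sub _

theorem translatedFun_translatedPoint : translatedFun f x r (translatedPoint f x r) = f x := by
  rw [translatedFun, translatedPoint, add_sub_cancel_right]

theorem gradient_translatedFun :
    gradient (translatedFun f x r) (translatedPoint f x r) = gradient f x := by
  rw [gradient, gradient, fderiv_translatedFun, translatedPoint, add_sub_cancel_right]

theorem fderiv_fderiv_translatedFun :
    fderiv ℝ (fderiv ℝ (translatedFun f x r)) (translatedPoint f x r) =
      fderiv ℝ (fderiv ℝ f) x := by
  rw [funext (fderiv_translatedFun f x r), fderiv_comp_sub, translatedPoint, add_sub_cancel_right]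

theorem unitGradient_translatedFun :
    unitGradient (translatedFun f x r) (translatedPoint f x r) = unitGradient f x := by
  rw [unitGradient, gradient_translatedFun, unitGradient]

theorem offsetMap_translatedPoint :
    offsetMap r (translatedPoint f x r, -unitGradient f x) = (x, unitGradient f x) := by
  simp [translatedPoint]

end TranslatedFun

section CriticalPoint

variable {d : ℕ} {f : E d → ℝ} {X : Set (E d)} {x : E d} {R r : ℝ}

theorem isCriticalPoint_of_mem_normalBundle (hx : x ∈ X)
    (h : (x, -unitGradient f x) ∈ normalBundle X) : IsCriticalPoint f X x := by
  obtain ⟨hfr, hnor, hn⟩ := mem_normalBundle_iff.1 h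
  refine ⟨hx, ?_⟩
  rw [normalCone, if_neg hfr.2]
  intro b hb
  have hg : 0 < ‖gradient f x‖ := norm_pos_iff.2 fun h0 => by simp [unitGradient, h0] at hn
  have hb' := hnor b hb
  rw [neg_neg, unitGradient, real_inner_smul_left] at hb'
  rw [neg_neg]
  exact nonpos_of_mul_nonpos_right hb' (inv_pos.2 hg)

theorem isRegularPair_normalBundle_iff (hX : HasReachAtLeast (closedCompl X) R) {n : E d} :
    IsRegularPair (normalBundle X) (x, -n) ↔
      IsRegularPair (normalBundleOfReach (closedCompl X)) (x, n) := by
  rw [normalBundle_eq_preimage hX, isRegularPair_preimage_offsetMap]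
  simp

theorem criticalTangentSpace_eq_comap (hX : HasReachAtLeast (closedCompl X) R) :
    criticalTangentSpace f X x =
      (tangentSpace (normalBundleOfReach (closedCompl X)) (x, unitGradient f x)).comap
        (offsetMap 0).toLinearMap := by
  rw [criticalTangentSpace, normalBundle_eq_preimage hX, tangentSpace_preimage_offsetMap]
  simp

theorem criticalTangentSpace_erosion (hX : HasReachAtLeast (closedCompl X) R) (hr : 0 < r)
    (hrR : r < R) :
    criticalTangentSpace (translatedFun f x r) (erosion X r) (translatedPoint f x r) =
      (tangentSpace (normalBundleOfReach (closedCompl X)) (x, unitGradient f x)).comap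
        (offsetMap r).toLinearMap := by
  rw [criticalTangentSpace, unitGradient_translatedFun, normalBundle_erosion_eq_preimage hX hr hrR,
    tangentSpace_preimage_offsetMap, offsetMap_translatedPoint]

theorem isCriticalPoint_erosion (hX : HasReachAtLeast (closedCompl X) R) (hr : 0 < r) (hrR : r < R)
    (hp : (x, unitGradient f x) ∈ normalBundleOfReach (closedCompl X)) :
    IsCriticalPoint (translatedFun f x r) (erosion X r) (translatedPoint f x r) := by
  refine isCriticalPoint_of_mem_normalBundle
    (hX.infDist_add_smul_of_mem_normalBundle hp hr.le hrR).ge ?_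
  rw [unitGradient_translatedFun, normalBundle_erosion_eq_preimage hX hr hrR, Set.mem_preimage,
    offsetMap_translatedPoint]
  exact hp

theorem isRegularPair_erosion (hX : HasReachAtLeast (closedCompl X) R) (hr : 0 < r) (hrR : r < R)
    (hreg : IsRegularPair (normalBundleOfReach (closedCompl X)) (x, unitGradient f x)) :
    IsRegularPair (normalBundle (erosion X r)) (translatedPoint f x r, -unitGradient f x) := by
  rwa [normalBundle_erosion_eq_preimage hX hr hrR, isRegularPair_preimage_offsetMap,
    offsetMap_translatedPoint]

theorem IsNondegenerateCriticalPoint.isRegularPair_closedCompl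
    (hx : IsNondegenerateCriticalPoint f X x) (hX : HasReachAtLeast (closedCompl X) R) :
    IsRegularPair (normalBundleOfReach (closedCompl X)) (x, unitGradient f x) :=
  (isRegularPair_normalBundle_iff hX).1 hx.isRegularPair

theorem IsNondegenerateCriticalPoint.eventually_erosion
    (hx : IsNondegenerateCriticalPoint f X x) (hX : HasReachAtLeast (closedCompl X) R)
    (hf : ContDiffAt ℝ 2 f x) :
    ∀ᶠ r in 𝓝[>] 0,
      IsNondegenerateCriticalPoint (translatedFun f x r) (erosion X r) (translatedPoint f x r) ∧
      index (restrictedHessian (translatedFun f x r) (erosion X r) (translatedPoint f x r)) =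
        index (restrictedHessian f X x) +
          Module.finrank ℝ (LinearMap.ker (LinearMap.fst ℝ (E d) (E d) ∘ₗ (tangentSpace
            (normalBundleOfReach (closedCompl X)) (x, unitGradient f x)).subtype)) := by
  have hreg := hx.isRegularPair_closedCompl hX
  filter_upwards [eventually_nondegenerate_index_restrictedHessian
    (fun w hw w' hw' => hX.inner_comm_of_mem_tangentSpace hreg hw hw') hf hx.gradient_ne_zero
    (criticalTangentSpace_eq_comap hX) hx.nondegenerate, Ioo_mem_nhdsGT hX.pos] with r hHess hr
  have hHess := hHess _ _ _ (fderiv_fderiv_translatedFun f x r) (gradient_translatedFun f x r)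
    (criticalTangentSpace_erosion hX hr.1 hr.2)
  refine ⟨⟨isCriticalPoint_erosion hX hr.1 hr.2 hreg.1, ?_, ?_, hHess.1⟩, hHess.2⟩
  · rw [gradient_translatedFun]
    exact hx.gradient_ne_zero
  · rw [unitGradient_translatedFun]
    exact isRegularPair_erosion hX hr.1 hr.2 hreg

end CriticalPoint

end ComplementaryRegular

end

open ComplementaryRegular in
theorem mainTheorem10_general (d : ℕ) (X : Set (E d)) (hX : 0 < reach (closedCompl X))
    (f : E d → ℝ) (x : E d) (hf : ContDiffAt ℝ 2 f x) (hx : IsNondegenerateCriticalPoint f X x) :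
    (∀ r : ℝ, 0 < r → ENNReal.ofReal r < reach (closedCompl X) →
      AdmitsNormalBundle (erosion X r) ∧
      IsCriticalPoint (translatedFun f x r) (erosion X r) (translatedPoint f x r) ∧
      translatedFun f x r (translatedPoint f x r) = f x) ∧
    (∃ κ b, IsPrincipalCurvatures (normalBundleOfReach (closedCompl X)) x (unitGradient f x) κ b) ∧
    ∃ r₀ > 0, ∀ r : ℝ, 0 < r → r < r₀ →
      IsNondegenerateCriticalPoint (translatedFun f x r) (erosion X r) (translatedPoint f x r) ∧
      ∀ κ b, IsPrincipalCurvatures (normalBundleOfReach (closedCompl X)) x (unitGradient f x) κ b →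
        index (restrictedHessian (translatedFun f x r) (erosion X r) (translatedPoint f x r)) =
          index (restrictedHessian f X x) + numInfinite κ := by
  obtain ⟨R, -, hR⟩ := exists_hasReachAtLeast_of_lt_reach isClosed_closure le_rfl
    (ENNReal.ofReal_zero.trans_lt hX)
  have hreg := hx.isRegularPair_closedCompl hR
  refine ⟨fun r hr hrX => ?_, hR.exists_isPrincipalCurvatures hreg, ?_⟩
  · obtain ⟨R', hrR', hR'⟩ := exists_hasReachAtLeast_of_lt_reach isClosed_closure hr.le hrX
    exact ⟨admitsNormalBundle_erosion hR' hr hrR', isCriticalPoint_erosion hR' hr hrR' hreg.1,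
      translatedFun_translatedPoint f x r⟩
  · obtain ⟨r₀, hr₀, hsub⟩ := mem_nhdsGT_iff_exists_Ioo_subset.1 (hx.eventually_erosion hR hf)
    refine ⟨r₀, hr₀, fun r hr hrr₀ => ?_⟩
    obtain ⟨hnondeg, hindex⟩ := hsub ⟨hr, hrr₀⟩
    exact ⟨hnondeg, fun κ b hκ => hκ.finrank_ker_fst hR hreg ▸ hindex⟩

open ComplementaryRegular in
theorem mainTheorem10 (d : ℕ) (X : Set (E d)) (hX : IsComplementaryRegular X)
    (f : E d → ℝ) (hf : ContDiff ℝ 2 f) (x : E d) (hx : IsNondegenerateCriticalPoint f X x) :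
    (∀ r : ℝ, 0 < r → ENNReal.ofReal r < reach (closedCompl X) →
      AdmitsNormalBundle (erosion X r) ∧
      IsCriticalPoint (translatedFun f x r) (erosion X r) (translatedPoint f x r) ∧
      translatedFun f x r (translatedPoint f x r) = f x) ∧
    (∃ κ b, IsPrincipalCurvatures (normalBundleOfReach (closedCompl X)) x (unitGradient f x) κ b) ∧
    ∃ r₀ > 0, ∀ r : ℝ, 0 < r → r < r₀ →
      IsNondegenerateCriticalPoint (translatedFun f x r) (erosion X r) (translatedPoint f x r) ∧
      ∀ κ b, IsPrincipalCurvatures (normalBundleOfReach (closedCompl X)) x (unitGradient f x) κ b →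
        index (restrictedHessian (translatedFun f x r) (erosion X r) (translatedPoint f x r)) =
          index (restrictedHessian f X x) + numInfinite κ := by
  exact mainTheorem10_general d X hX.reach_compl_pos f x hf.contDiffAt hx
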